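/- **Conventions.** The basic open subsets of the extended plane $\hat{\mathbb C}$ are the open rectangles whose vertices have rational coordinates and the sets $\hat{\mathbb C}-\overline{D_r(0)}$ with $r>0$ rational, where $D_r(z)$ is the open disk with center $z$ and radius $r$; they are indexed effectively by natural numbers. A *name* of a point $z\in\hat{\mathbb C}$ is a sequence that lists (the indices of) all basic open sets that contain $z$, and no others; a real number is named as a point of $\hat{\mathbb C}$. A *name* of a partial function $f$ from $\hat{\mathbb C}$ to $\hat{\mathbb C}$ consists of a set $X\subseteq\mathbb N$ and a code of a Turing machine with a one-way output tape which, given access to the oracle $X$ and any name of any $z\in\operatorname{dom}(f)$ on its input tape, writes a name of $f(z)$ on its output tape when allowed to run indefinitely. A real-valued function $u$ whose domain is an open connected set $D\subseteq\hat{\mathbb C}$ is *harmonic* if it is $C^2$ with $u_{xx}+u_{yy}=0$ on $D-\{\infty\}$ and, in case $\infty\in D$, the function $z\mapsto u(1/z)$ is harmonic on some disk about $0$. Harmonic functions $u,v$ on an open set of the plane are such that $v$ is a *harmonic conjugate* of $u$ if $u_x=v_y$ and $u_y=-v_x$. **Theorem (Computable conjugation).** From a name of a harmonic function $u$ and names of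 $z_0\in\mathbb C$ and $R>0$ such that $\overline{D_R(z_0)}\subseteq\operatorname{dom}(u)$, it is possible to uniformly compute a name of a harmonic conjugate of $u$ with domain $D_R(z_0)$. That is, there is a single Turing machine (without oracle) which, for all such $u,z_0,R$, whenever a name of $u$, a name of $z_0$ and a name of $R$ are written on its input tape, writes on its output tape a name of the function $\tilde u$ with domain $D_R(z_0)$, where $\tilde u$ is the harmonic conjugate of $u$ on $D_R(z_0)$ that vanishes at $z_0$. Moreover, for all $z\in D_R(z_0)$ and all $r$ with $|z-z_0|<r<R$, $$\tilde u(z)=\frac1{2\pi i}\int_0^{2\pi}u(z_0+re^{i\theta})\,\frac{re^{-i\theta}(z-z_0)-re^{i\theta}\,\overline{(z-z_0)}}{|re^{i\theta}-(z-z_0)|^2}\,d\theta .$$ -/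

import Mathlib

open Complex InnerProductSpace

namespace ComputableConjugation

noncomputable section

/-- The extended complex plane. -/
abbrev Sphere : Type := OnePoint ℂ

/-! ### Basic open sets of the extended plane -/

/-- A notation of the rational numbers by natural numbers: `⟨a, ⟨b, d⟩⟩` denotes
`(a - b) / (d + 1)`. Every rational number is denoted. -/
def ratOf (k : ℕ) : ℚ :=
  ((k.unpair.1 : ℚ) - (k.unpair.2.unpair.1 : ℚ)) / ((k.unpair.2.unpair.2 : ℚ) + 1)

/-- A notation of the positive rational numbers: `⟨a, d⟩` denotes `(a + 1) / (d + 1)`. -/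
def posRatOf (k : ℕ) : ℚ := ((k.unpair.1 : ℚ) + 1) / ((k.unpair.2 : ℚ) + 1)

/-- The open rectangle `(a, b) × (c, d)`, as a subset of the extended plane. -/
def openRect (a b c d : ℚ) : Set Sphere :=
  (fun z : ℂ => (z : Sphere)) ''
    {z : ℂ | (a : ℝ) < z.re ∧ z.re < (b : ℝ) ∧ (c : ℝ) < z.im ∧ z.im < (d : ℝ)}

/-- The complement in the extended plane of the closed disk of radius `r` about `0`. -/
def exteriorDisk (r : ℚ) : Set Sphere :=
  ((fun z : ℂ => (z : Sphere)) '' Metric.closedBall (0 : ℂ) (r : ℝ))ᶜ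

/-- The basic open set with index `k`: the indices `⟨0, m⟩` denote the exteriors of disks of
positive rational radius about `0`, the others the rational rectangles. -/
def basicSet (k : ℕ) : Set Sphere :=
  if k.unpair.1 = 0 then exteriorDisk (posRatOf k.unpair.2)
  else
    openRect (ratOf k.unpair.2.unpair.1.unpair.1) (ratOf k.unpair.2.unpair.1.unpair.2)
      (ratOf k.unpair.2.unpair.2.unpair.1) (ratOf k.unpair.2.unpair.2.unpair.2)

/-- `p` is a name of the point `z`: a list (in any order, repetitions allowed) of all the basic
open sets that contain `z`, and of no others. -/
def IsPointName (p : ℕ → ℕ) (z : Sphere) : Prop :=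
  ∀ k : ℕ, (∃ i, p i = k) ↔ z ∈ basicSet k

/-! ### Oracle machines with an infinite input tape and a one-way output tape

The program of a machine is a code of a partial recursive function. It is applied to the pair
(internal state, last reply) and produces the next internal state together with one action: read
the next cell of the input tape, put a question to the oracle, or write a symbol at the end of
the output tape. All the internal work between two such actions is the evaluation of the program;
if that evaluation diverges, then the machine writes nothing more. -/

/-- A configuration of a machine: the internal state, the last reply of the input tape or of the
oracle, the position of the input head, and what has been written on the output tape so far. -/
structure Config where
  state : ℕ
  reply : ℕ
  head : ℕ
  output : List ℕ

/-- The initial configuration. -/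
def Config.init : Config := ⟨0, 0, 0, []⟩

open Classical in
/-- The characteristic function of a set of natural numbers. -/
def bit (X : Set ℕ) (n : ℕ) : ℕ := if n ∈ X then 1 else 0

/-- The effect of the value `⟨s, ⟨t, x⟩⟩` of the program on a configuration: the new state is `s`,
and the action is to read the next input cell (`t = 0`), to ask the oracle whether it contains
`x` (`t = 1`), or to write `x` on the output tape (`2 ≤ t`). -/
def act (X : Set ℕ) (p : ℕ → ℕ) (C : Config) (k : ℕ) : Config :=
  match k.unpair.2.unpair.1 with
  | 0 => ⟨k.unpair.1, p C.head, C.head + 1, C.output⟩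
  | 1 => ⟨k.unpair.1, bit X k.unpair.2.unpair.2, C.head, C.output⟩
  | _ => ⟨k.unpair.1, 0, C.head, C.output ++ [k.unpair.2.unpair.2]⟩

/-- One step of the machine with program `e`, oracle `X` and input tape `p`. -/
def step (e : Nat.Partrec.Code) (X : Set ℕ) (p : ℕ → ℕ) (C : Config) : Part Config :=
  (e.eval (Nat.pair C.state C.reply)).map (act X p C)

/-- The configuration after `t` steps (undefined if the machine hangs before). -/
def run (e : Nat.Partrec.Code) (X : Set ℕ) (p : ℕ → ℕ) : ℕ → Part Config
  | 0 => Part.some Config.init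
  | t + 1 => (run e X p t).bind (step e X p)

/-- When it is allowed to run indefinitely with oracle `X` and input tape `p`, the machine `e`
writes the infinite sequence `q` on its output tape. -/
def Writes (e : Nat.Partrec.Code) (X : Set ℕ) (p q : ℕ → ℕ) : Prop :=
  ∀ n : ℕ, ∃ t : ℕ, ∃ C ∈ run e X p t, C.output[n]? = some (q n)

/-! ### Names of functions -/

/-- The oracle `X` and the machine `e` form a name of the function `f` with domain `D`: with
oracle `X`, the machine turns every name of a point `z` of `D` into a name of `f z`. (A name
carries no information on `D`; the values of `f` off `D` play no role.) -/
def IsFunctionName (X : Set ℕ) (e : Nat.Partrec.Code) (D : Set Sphere) (f : Sphere → Sphere) :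
    Prop :=
  ∀ z ∈ D, ∀ p : ℕ → ℕ, IsPointName p z → ∃ q : ℕ → ℕ, Writes e X p q ∧ IsPointName q (f z)

/-- A real-valued function as a function into the extended plane. -/
def realFun (u : Sphere → ℝ) (z : Sphere) : Sphere := (((u z : ℝ) : ℂ) : Sphere)

/-- The pair of an oracle and a machine as a sequence on a tape: the code number of the machine,
followed by the characteristic sequence of the oracle. -/
def functionTape (X : Set ℕ) (e : Nat.Partrec.Code) : ℕ → ℕ
  | 0 => Encodable.encode e
  | n + 1 => bit X n

/-- Three sequences on one tape, interleaved. -/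
def triple (a b c : ℕ → ℕ) (n : ℕ) : ℕ :=
  if n % 3 = 0 then a (n / 3) else if n % 3 = 1 then b (n / 3) else c (n / 3)

/-! ### Harmonic functions on domains of the extended plane, harmonic conjugates -/

/-- `z ↦ 1 / z` from the plane to the extended plane, with `1 / 0 = ∞`. -/
def invPt (z : ℂ) : Sphere :=
  open Classical in if z = 0 then OnePoint.infty else ((z⁻¹ : ℂ) : Sphere)

/-- `u` is a harmonic function with domain `D`, an open connected subset of the extended plane. -/
structure IsHarmonicOn (u : Sphere → ℝ) (D : Set Sphere) : Prop where
  isOpen : IsOpen D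
  isConnected : IsConnected D
  finite : HarmonicOnNhd (fun z : ℂ => u (z : Sphere)) {z : ℂ | (z : Sphere) ∈ D}
  infty : OnePoint.infty ∈ D →
    ∃ ρ : ℝ, 0 < ρ ∧ HarmonicOnNhd (fun z : ℂ => u (invPt z)) (Metric.ball 0 ρ)

/-- `v` is a harmonic conjugate of `u` on the subset `s` of the plane: both are harmonic and
satisfy the Cauchy-Riemann equations `u_x = v_y`, `u_y = - v_x`. -/
structure IsHarmonicConjugateOn (u v : ℂ → ℝ) (s : Set ℂ) : Prop where
  left : HarmonicOnNhd u s
  right : HarmonicOnNhd v s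
  cr₁ : ∀ z ∈ s, fderiv ℝ u z 1 = fderiv ℝ v z I
  cr₂ : ∀ z ∈ s, fderiv ℝ u z I = -fderiv ℝ v z 1

/-- The conjugate Poisson integral of `u` over the circle of radius `r` about `z₀`:
`(1 / 2πi) ∫₀^{2π} u(z₀ + r e^{iθ}) (r e^{-iθ} w - r e^{iθ} w̄) / |r e^{iθ} - w|² dθ`, where
`w = z - z₀`. -/
def conjugatePoisson (u : ℂ → ℝ) (z₀ : ℂ) (r : ℝ) (z : ℂ) : ℂ :=
  (1 / (2 * (Real.pi : ℂ) * I)) *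
    ∫ θ in (0 : ℝ)..(2 * Real.pi),
      (u (z₀ + r * exp (I * θ)) : ℂ) *
        ((r * exp (-(I * θ)) * (z - z₀) - r * exp (I * θ) * (starRingEnd ℂ) (z - z₀)) /
          ((‖r * exp (I * θ) - (z - z₀)‖ : ℝ) : ℂ) ^ 2)

end

end ComputableConjugation

open ComputableConjugation

/-! On a slightly larger disk `u` is the real part of a holomorphic `F`
(`IsHarmonicOn.exists_analyticOnNhd`), and the normalized conjugate is `Im F - Im F(z₀)`. The
problem is to compute it from a name of `u` alone, without access to `F`.

The machine `M` does no analysis: it copies its tape into an oracle and attaches one fixed machine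
code (`exists_copy_machine`). That fixed machine, given the oracle and a name of `z`, has only to
enumerate the basic sets containing the value. It searches through all possible certificates, so it
suffices that certificates form a primitive recursive predicate, that they are sound, and that every
true membership has one (`exists_search_machine`).

A certificate consists of a polynomial `P` with Gaussian rational coefficients and finitely many
simulated runs of the machine for `u`, each on a finite list of basic sets containing a small disk.
Every point of such a disk has a name beginning with that list, so the output of one run bounds `u`
on the whole disk. Enough disks show `|u - Re P| ≤ ε` on a disk of radius `ρ` about `z₀`. The
Borel–Carathéodory inequality (`abs_im_sub_im_le`) then bounds the error of `Im P(z) - Im P(z₀)` as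
a value of the conjugate. The values of `P` are enclosed by ball arithmetic in Horner form.
Soundness is `ValueCert.mem_basicSet`.

Completeness (`exists_certified`) rests on Taylor polynomials, on the openness of the basic sets,
and on compactness of the closed disk, which makes finitely many runs suffice.

The integral formula plays no part in the computation. The Herglotz integral of `Re F` over a circle
is holomorphic with the same real part and is real at the center, so its imaginary part is the
conjugate; the imaginary part of its kernel is the conjugate Poisson kernel. -/

namespace ComputableConjugation

/-! ### Primitive recursive functions and predicates -/

section Primitive

variable {α β : Type*} [Primcodable α] [Primcodable β]

/-- These closure properties are put in pointwise form so that `fun_prop` can use them. -/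
theorem primrec_add {f g : α → ℕ} (hf : Primrec f) (hg : Primrec g) :
    Primrec fun a => f a + g a := Primrec.nat_add.comp hf hg

theorem primrec_mul {f g : α → ℕ} (hf : Primrec f) (hg : Primrec g) :
    Primrec fun a => f a * g a := Primrec.nat_mul.comp hf hg

theorem primrec_sub {f g : α → ℕ} (hf : Primrec f) (hg : Primrec g) :
    Primrec fun a => f a - g a := Primrec.nat_sub.comp hf hg

theorem primrec_div {f g : α → ℕ} (hf : Primrec f) (hg : Primrec g) :
    Primrec fun a => f a / g a := Primrec.nat_div.comp hf hg

theorem primrec_mod {f g : α → ℕ} (hf : Primrec f) (hg : Primrec g) :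
    Primrec fun a => f a % g a := Primrec.nat_mod.comp hf hg

theorem primrec_unpair {f : α → ℕ} (hf : Primrec f) : Primrec fun a => (f a).unpair :=
  Primrec.unpair.comp hf

theorem primrec_natPair {f g : α → ℕ} (hf : Primrec f) (hg : Primrec g) :
    Primrec fun a => Nat.pair (f a) (g a) := Primrec₂.natPair.comp hf hg

theorem primrec_encode {f : α → β} (hf : Primrec f) :
    Primrec fun a => Encodable.encode (f a) := Primrec.encode.comp hf

theorem primrec_ofNat {δ : Type*} [Denumerable δ] {f : α → ℕ} (hf : Primrec f) :
    Primrec fun a => Denumerable.ofNat δ (f a) := (Primrec.ofNat δ).comp hf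

theorem primrec_length {f : α → List β} (hf : Primrec f) :
    Primrec fun a => (f a).length := Primrec.list_length.comp hf

theorem primrec_append {f g : α → List β} (hf : Primrec f) (hg : Primrec g) :
    Primrec fun a => f a ++ g a := Primrec.list_append.comp hf hg

theorem primrec_cons {f : α → β} {g : α → List β} (hf : Primrec f) (hg : Primrec g) :
    Primrec fun a => f a :: g a := Primrec.list_cons.comp hf hg

theorem primrec_getElem? {f : α → List β} {g : α → ℕ} (hf : Primrec f) (hg : Primrec g) :
    Primrec fun a => (f a)[g a]? := Primrec.list_getElem?.comp hf hg

theorem primrec_some {f : α → β} (hf : Primrec f) : Primrec fun a => some (f a) :=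
  Primrec.option_some.comp hf

theorem primrec_evaln {f g : α → ℕ} {c : α → Nat.Partrec.Code} (hf : Primrec f) (hc : Primrec c)
    (hg : Primrec g) : Primrec fun a => Nat.Partrec.Code.evaln (f a) (c a) (g a) :=
  Nat.Partrec.Code.primrec_evaln.comp (Primrec.pair (Primrec.pair hf hc) hg)

theorem primrecPred_lt {f g : α → ℕ} (hf : Primrec f) (hg : Primrec g) :
    PrimrecPred fun a => f a < g a := Primrec.nat_lt.comp hf hg

theorem primrecPred_le {f g : α → ℕ} (hf : Primrec f) (hg : Primrec g) :
    PrimrecPred fun a => f a ≤ g a := Primrec.nat_le.comp hf hg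

theorem primrecPred_eq {f g : α → β} (hf : Primrec f) (hg : Primrec g) :
    PrimrecPred fun a => f a = g a := Primrec.eq.comp hf hg

theorem primrecPred_forall_lt {f : α → ℕ} {p : α → ℕ → Prop} (hf : Primrec f)
    (hp : PrimrecPred fun q : α × ℕ => p q.1 q.2) : PrimrecPred fun a => ∀ i < f a, p a i := by
  have h : PrimrecRel fun (i : ℕ) (a : α) => p a i :=
    (hp.comp (Primrec.pair Primrec.snd Primrec.fst)).primrecRel
  exact (h.forall_mem_list.comp (Primrec.list_range.comp hf) Primrec.id).of_eq (by simp)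

theorem primrecPred_exists_lt {f : α → ℕ} {p : α → ℕ → Prop} (hf : Primrec f)
    (hp : PrimrecPred fun q : α × ℕ => p q.1 q.2) : PrimrecPred fun a => ∃ i < f a, p a i := by
  have h : PrimrecRel fun (i : ℕ) (a : α) => p a i :=
    (hp.comp (Primrec.pair Primrec.snd Primrec.fst)).primrecRel
  exact (h.exists_mem_list.comp (Primrec.list_range.comp hf) Primrec.id).of_eq (by simp)

theorem primrecPred_forall_mem {f : α → List β} {p : α → β → Prop} (hf : Primrec f)
    (hp : PrimrecPred fun q : α × β => p q.1 q.2) : PrimrecPred fun a => ∀ b ∈ f a, p a b := by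
  have h : PrimrecRel fun (b : β) (a : α) => p a b :=
    (hp.comp (Primrec.pair Primrec.snd Primrec.fst)).primrecRel
  exact h.forall_mem_list.comp hf Primrec.id

end Primitive

attribute [fun_prop] Primrec PrimrecPred
attribute [fun_prop] Primrec.id Primrec.const Primrec.comp Primrec.fst Primrec.snd Primrec.pair
  primrec_add primrec_mul primrec_sub primrec_div primrec_mod primrec_unpair primrec_natPair
  primrec_encode primrec_ofNat primrec_length primrec_append primrec_cons primrec_getElem?
  primrec_some primrec_evaln
attribute [fun_prop] PrimrecPred.and PrimrecPred.or PrimrecPred.not primrecPred_lt primrecPred_le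
  primrecPred_eq

/-! ### Rational-valued functions that are primitive recursive on codes -/

/-- A rational-valued function has primitive recursive codes. -/
@[fun_prop]
def RatPrimrec {α : Type*} [Primcodable α] (g : α → ℚ) : Prop :=
  ∃ f : α → ℕ, Primrec f ∧ ∀ a, ratOf (f a) = g a

section Rational

variable {α : Type*} [Primcodable α]

theorem ratOf_pair (a b d : ℕ) :
    ratOf (Nat.pair a (Nat.pair b d)) = ((a : ℚ) - b) / (d + 1) := by
  simp [ratOf]

theorem ratPrimrec_ratOf {f : α → ℕ} (hf : Primrec f) : RatPrimrec fun a => ratOf (f a) :=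
  ⟨f, hf, fun _ => rfl⟩

theorem ratPrimrec_natCast {f : α → ℕ} (hf : Primrec f) : RatPrimrec fun a => (f a : ℚ) :=
  ⟨fun a => Nat.pair (f a) (Nat.pair 0 0), by fun_prop, fun a => by simp [ratOf_pair]⟩

theorem exists_ratOf_eq (q : ℚ) : ∃ k, ratOf k = q := by
  -- The positive and the negative part of the numerator; a denominator is coded by its predecessor.
  refine ⟨Nat.pair q.num.toNat (Nat.pair (-q.num).toNat (q.den - 1)), ?_⟩
  rw [ratOf_pair]
  have h1 : ((q.den - 1 : ℕ) : ℚ) + 1 = q.den := by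
    have := q.den_pos
    exact_mod_cast (by omega : q.den - 1 + 1 = q.den)
  have h2 : (q.num.toNat : ℚ) - ((-q.num).toNat : ℚ) = q.num := by
    have := Int.toNat_sub_toNat_neg q.num
    exact_mod_cast this
  rw [h1, h2, Rat.num_div_den]

theorem ratPrimrec_const (q : ℚ) : RatPrimrec fun _ : α => q := by
  obtain ⟨k, hk⟩ := exists_ratOf_eq q
  exact ⟨fun _ => k, by fun_prop, fun _ => hk⟩

theorem ratPrimrec_comp {β : Type*} [Primcodable β] {f : β → ℚ} {g : α → β} (hf : RatPrimrec f)
    (hg : Primrec g) : RatPrimrec fun a => f (g a) := by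
  obtain ⟨f', hf', h⟩ := hf
  exact ⟨fun a => f' (g a), hf'.comp hg, fun a => h _⟩

theorem ratPrimrec_neg {f : α → ℚ} (hf : RatPrimrec f) : RatPrimrec fun a => -f a := by
  obtain ⟨f, hf', h⟩ := hf
  refine ⟨fun a => Nat.pair (f a).unpair.2.unpair.1
    (Nat.pair (f a).unpair.1 (f a).unpair.2.unpair.2), by fun_prop, fun a => ?_⟩
  beta_reduce
  rw [← h, ratOf_pair, ratOf]
  ring

theorem ratPrimrec_add {f g : α → ℚ} (hf : RatPrimrec f) (hg : RatPrimrec g) :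
    RatPrimrec fun a => f a + g a := by
  obtain ⟨f, hf', h⟩ := hf
  obtain ⟨g, hg', h'⟩ := hg
  -- The last component is `dd' + d + d' = (d + 1)(d' + 1) - 1`, since denominators are coded by
  -- predecessors.
  refine ⟨fun a => Nat.pair
    ((f a).unpair.1 * ((g a).unpair.2.unpair.2 + 1) + (g a).unpair.1 * ((f a).unpair.2.unpair.2 + 1))
    (Nat.pair ((f a).unpair.2.unpair.1 * ((g a).unpair.2.unpair.2 + 1)
      + (g a).unpair.2.unpair.1 * ((f a).unpair.2.unpair.2 + 1))
    ((f a).unpair.2.unpair.2 * (g a).unpair.2.unpair.2 + (f a).unpair.2.unpair.2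
      + (g a).unpair.2.unpair.2)), by fun_prop, fun a => ?_⟩
  beta_reduce
  rw [← h, ← h', ratOf_pair, ratOf, ratOf, div_add_div _ _ (by positivity) (by positivity)]
  push_cast
  congr 1 <;> ring

theorem ratPrimrec_mul {f g : α → ℚ} (hf : RatPrimrec f) (hg : RatPrimrec g) :
    RatPrimrec fun a => f a * g a := by
  obtain ⟨f, hf', h⟩ := hf
  obtain ⟨g, hg', h'⟩ := hg
  refine ⟨fun a => Nat.pair
    ((f a).unpair.1 * (g a).unpair.1 + (f a).unpair.2.unpair.1 * (g a).unpair.2.unpair.1)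
    (Nat.pair ((f a).unpair.2.unpair.1 * (g a).unpair.1
      + (f a).unpair.1 * (g a).unpair.2.unpair.1)
    ((f a).unpair.2.unpair.2 * (g a).unpair.2.unpair.2 + (f a).unpair.2.unpair.2
      + (g a).unpair.2.unpair.2)), by fun_prop, fun a => ?_⟩
  beta_reduce
  rw [← h, ← h', ratOf_pair, ratOf, ratOf, div_mul_div_comm]
  push_cast
  congr 1 <;> ring

theorem ratPrimrec_sub {f g : α → ℚ} (hf : RatPrimrec f) (hg : RatPrimrec g) :
    RatPrimrec fun a => f a - g a := by
  simp only [sub_eq_add_neg]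
  exact ratPrimrec_add hf (ratPrimrec_neg hg)

theorem ratPrimrec_sq {f : α → ℚ} (hf : RatPrimrec f) : RatPrimrec fun a => f a ^ 2 := by
  simp only [sq]
  exact ratPrimrec_mul hf hf

theorem ratPrimrec_abs {f : α → ℚ} (hf : RatPrimrec f) : RatPrimrec fun a => |f a| := by
  obtain ⟨f, hf', h⟩ := hf
  -- With truncated subtraction, `(a - b) + (b - a) = |a - b|`.
  refine ⟨fun a => Nat.pair (((f a).unpair.1 - (f a).unpair.2.unpair.1)
      + ((f a).unpair.2.unpair.1 - (f a).unpair.1))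
    (Nat.pair 0 (f a).unpair.2.unpair.2), by fun_prop, fun a => ?_⟩
  beta_reduce
  rw [← h, ratOf_pair, ratOf, abs_div, abs_of_pos (by positivity : (0 : ℚ) < _ + 1)]
  congr 1
  rcases le_total (f a).unpair.1 (f a).unpair.2.unpair.1 with hle | hle
  · have : ((f a).unpair.1 : ℚ) ≤ (f a).unpair.2.unpair.1 := by exact_mod_cast hle
    rw [abs_of_nonpos (by linarith), Nat.sub_eq_zero_of_le hle]
    push_cast [hle]
    ring
  · have : ((f a).unpair.2.unpair.1 : ℚ) ≤ (f a).unpair.1 := by exact_mod_cast hle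
    rw [abs_of_nonneg (by linarith), Nat.sub_eq_zero_of_le hle]
    push_cast [hle]
    ring

theorem ratPrimrec_posRatOf {f : α → ℕ} (hf : Primrec f) : RatPrimrec fun a => posRatOf (f a) :=
  ⟨fun a => Nat.pair ((f a).unpair.1 + 1) (Nat.pair 0 (f a).unpair.2), by fun_prop,
    fun a => by simp [ratOf_pair, posRatOf]⟩

theorem primrecPred_ratLt {f g : α → ℚ} (hf : RatPrimrec f) (hg : RatPrimrec g) :
    PrimrecPred fun a => f a < g a := by
  obtain ⟨f, hf', h⟩ := hf
  obtain ⟨g, hg', h'⟩ := hg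
  -- Cross-multiplied, with the subtracted terms moved across, so that the comparison takes place in
  -- `ℕ`.
  have : PrimrecPred fun a =>
      (f a).unpair.1 * ((g a).unpair.2.unpair.2 + 1)
        + (g a).unpair.2.unpair.1 * ((f a).unpair.2.unpair.2 + 1)
      < (g a).unpair.1 * ((f a).unpair.2.unpair.2 + 1)
        + (f a).unpair.2.unpair.1 * ((g a).unpair.2.unpair.2 + 1) := by fun_prop
  refine this.of_eq fun a => ?_
  rw [← h, ← h', ratOf, ratOf, div_lt_div_iff₀ (by positivity) (by positivity)]
  rw [← Nat.cast_lt (α := ℚ)]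
  push_cast
  constructor <;> intro h <;> linarith

theorem primrecPred_ratLe {f g : α → ℚ} (hf : RatPrimrec f) (hg : RatPrimrec g) :
    PrimrecPred fun a => f a ≤ g a :=
  (primrecPred_ratLt hg hf).not.of_eq fun a => by simp

end Rational

attribute [fun_prop] ratPrimrec_ratOf ratPrimrec_natCast ratPrimrec_const ratPrimrec_comp
  ratPrimrec_neg ratPrimrec_add ratPrimrec_mul ratPrimrec_sub ratPrimrec_sq ratPrimrec_abs
  ratPrimrec_posRatOf primrecPred_ratLt primrecPred_ratLe

/-! ### Runs of machines -/

section Runs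

variable {e : Nat.Partrec.Code} {X : Set ℕ} {p : ℕ → ℕ}

theorem mem_run_succ {t : ℕ} {C : Config} :
    C ∈ run e X p (t + 1) ↔
      ∃ B ∈ run e X p t, ∃ k ∈ e.eval (Nat.pair B.state B.reply), act X p B k = C := by
  simp only [run, step, Part.mem_bind_iff, Part.mem_map_iff]

theorem act_read {C : Config} {k : ℕ} (h : k.unpair.2.unpair.1 = 0) :
    act X p C k = ⟨k.unpair.1, p C.head, C.head + 1, C.output⟩ := by
  simp only [act, h]

theorem act_ask {C : Config} {k : ℕ} (h : k.unpair.2.unpair.1 = 1) :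
    act X p C k = ⟨k.unpair.1, bit X k.unpair.2.unpair.2, C.head, C.output⟩ := by
  simp only [act, h]

theorem act_write {C : Config} {k : ℕ} (h : 2 ≤ k.unpair.2.unpair.1) :
    act X p C k = ⟨k.unpair.1, 0, C.head, C.output ++ [k.unpair.2.unpair.2]⟩ := by
  obtain ⟨n, hn⟩ := Nat.exists_eq_add_of_le' h
  simp only [act, hn]

theorem output_act (C : Config) (k : ℕ) :
    (act X p C k).output =
      if 2 ≤ k.unpair.2.unpair.1 then C.output ++ [k.unpair.2.unpair.2] else C.output := by
  split_ifs with h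
  · rw [act_write h]
  · have : k.unpair.2.unpair.1 = 0 ∨ k.unpair.2.unpair.1 = 1 := by omega
    rcases this with h | h
    · rw [act_read h]
    · rw [act_ask h]

theorem output_prefix_of_mem_run {t s : ℕ} {B C : Config} (hB : B ∈ run e X p t)
    (hC : C ∈ run e X p (t + s)) : B.output <+: C.output := by
  induction s generalizing C with
  | zero => rw [Part.mem_unique hB hC]
  | succ s ih =>
    obtain ⟨A, hA, k, -, rfl⟩ := mem_run_succ.1 hC
    refine (ih hA).trans ?_
    rw [output_act]
    split_ifs
    · exact List.prefix_append _ _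
    · exact List.prefix_refl _

theorem getElem?_output_unique {t s n x y : ℕ} {B C : Config} (hB : B ∈ run e X p t)
    (hC : C ∈ run e X p s) (hx : B.output[n]? = some x) (hy : C.output[n]? = some y) : x = y := by
  rcases le_total t s with h | h
  · obtain ⟨d, rfl⟩ := Nat.exists_eq_add_of_le h
    obtain ⟨l, hl⟩ := output_prefix_of_mem_run hB hC
    rw [← hl, List.getElem?_append_left (List.getElem?_eq_some_iff.1 hx).1, hx] at hy
    exact Option.some_injective _ hy
  · obtain ⟨d, rfl⟩ := Nat.exists_eq_add_of_le h
    obtain ⟨l, hl⟩ := output_prefix_of_mem_run hC hB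
    rw [← hl, List.getElem?_append_left (List.getElem?_eq_some_iff.1 hy).1, hy] at hx
    exact (Option.some_injective _ hx).symm

/-- At step `t`, the machine `e` writes the symbol `x`. -/
def WritesAt (e : Nat.Partrec.Code) (X : Set ℕ) (p : ℕ → ℕ) (t x : ℕ) : Prop :=
  ∃ C ∈ run e X p t, ∃ k ∈ e.eval (Nat.pair C.state C.reply),
    2 ≤ k.unpair.2.unpair.1 ∧ k.unpair.2.unpair.2 = x

theorem exists_writesAt_of_mem_output {t x : ℕ} {C : Config} (hC : C ∈ run e X p t)
    (hx : x ∈ C.output) : ∃ s, WritesAt e X p s x := by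
  induction t generalizing C with
  | zero =>
    simp only [run, Part.mem_some_iff] at hC
    simp [hC, Config.init] at hx
  | succ t ih =>
    obtain ⟨B, hB, k, hk, rfl⟩ := mem_run_succ.1 hC
    rw [output_act] at hx
    split_ifs at hx with h
    · rcases List.mem_append.1 hx with hx | hx
      · exact ih hB hx
      · exact ⟨t, B, hB, k, hk, h, (List.mem_singleton.1 hx).symm⟩
    · exact ih hB hx

/-- Output is only appended, so a cell never changes once written. Hence the range of the written
sequence can be studied through single writing steps. -/
theorem Writes.exists_eq_iff {q : ℕ → ℕ} (h : Writes e X p q) (x : ℕ) :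
    (∃ n, q n = x) ↔ ∃ t, WritesAt e X p t x := by
  constructor
  · rintro ⟨n, rfl⟩
    obtain ⟨t, C, hC, hn⟩ := h n
    exact exists_writesAt_of_mem_output hC (List.mem_of_getElem? hn)
  · rintro ⟨t, B, hB, k, hk, h2, rfl⟩
    have hC : act X p B k ∈ run e X p (t + 1) := mem_run_succ.2 ⟨B, hB, k, hk, rfl⟩
    have hlen : (act X p B k).output[B.output.length]? = some k.unpair.2.unpair.2 := by
      rw [output_act, if_pos h2]
      simp
    obtain ⟨s, C, hC', hn⟩ := h B.output.length
    exact ⟨_, (getElem?_output_unique hC hC' hlen hn).symm⟩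

/-- A machine that writes infinitely many symbols writes a sequence. -/
theorem exists_writes_of_length_unbounded
    (h : ∀ n, ∃ t, ∃ C ∈ run e X p t, n < C.output.length) : ∃ q, Writes e X p q := by
  choose t C hC hlt using h
  exact ⟨fun n => (C n).output[n]'(hlt n), fun n => ⟨t n, C n, hC n,
    List.getElem?_eq_getElem (hlt n)⟩⟩

end Runs

/-! ### Machines given by a strategy -/

/-- The program of the machine whose actions are determined by the list of all replies so far. -/
def strategyProgram (F : List ℕ → ℕ × ℕ) (n : ℕ) : ℕ :=
  let H := Denumerable.ofNat (List ℕ) n.unpair.1 ++ [n.unpair.2]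
  Nat.pair (Encodable.encode H) (Nat.pair (F H).1 (F H).2)

theorem exists_code_eval_strategyProgram {F : List ℕ → ℕ × ℕ} (hF : Primrec F) :
    ∃ e : Nat.Partrec.Code, ∀ n, e.eval n = Part.some (strategyProgram F n) := by
  have h : Primrec (strategyProgram F) := by
    unfold strategyProgram
    fun_prop
  obtain ⟨e, he⟩ := Nat.Partrec.Code.exists_code.1
    (Nat.Partrec.of_primrec (Primrec.nat_iff.1 h))
  exact ⟨e, fun n => by rw [he]; rfl⟩

/-- The list of replies and the configuration of a strategy machine after `t` steps; the last
reply of the configuration is not yet on the list. -/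
noncomputable def strategyRun (F : List ℕ → ℕ × ℕ) (X : Set ℕ) (p : ℕ → ℕ) : ℕ → List ℕ × Config
  | 0 => ([], Config.init)
  | t + 1 =>
    let H := (strategyRun F X p t).1 ++ [(strategyRun F X p t).2.reply]
    (H, act X p (strategyRun F X p t).2
      (Nat.pair (Encodable.encode H) (Nat.pair (F H).1 (F H).2)))

section Strategy

variable {F : List ℕ → ℕ × ℕ} {e : Nat.Partrec.Code} {X : Set ℕ} {p : ℕ → ℕ}

theorem state_act (C : Config) (k : ℕ) : (act X p C k).state = k.unpair.1 := by
  rcases Nat.lt_or_ge k.unpair.2.unpair.1 2 with h | h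
  · have : k.unpair.2.unpair.1 = 0 ∨ k.unpair.2.unpair.1 = 1 := by omega
    rcases this with h | h
    · rw [act_read h]
    · rw [act_ask h]
  · rw [act_write h]

theorem state_strategyRun (t : ℕ) :
    (strategyRun F X p t).2.state = Encodable.encode (strategyRun F X p t).1 := by
  cases t with
  | zero => simp [strategyRun, Config.init]
  | succ t => simp [strategyRun, state_act]

theorem run_eq_strategyRun (he : ∀ n, e.eval n = Part.some (strategyProgram F n)) (t : ℕ) :
    run e X p t = Part.some (strategyRun F X p t).2 := by
  induction t with
  | zero => rfl
  | succ t ih =>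
    rw [run, ih, Part.bind_some, step, he, Part.map_some]
    simp [strategyProgram, strategyRun, state_strategyRun]

theorem length_strategyRun (t : ℕ) : (strategyRun F X p t).1.length = t := by
  induction t with
  | zero => rfl
  | succ t ih => simp [strategyRun, ih]

theorem getElem?_strategyRun_succ (i s : ℕ) :
    (strategyRun F X p (i + 1 + s)).1[i]? = some (strategyRun F X p i).2.reply := by
  induction s with
  | zero => simp [strategyRun, length_strategyRun]
  | succ s ih =>
    rw [← Nat.add_assoc, strategyRun, List.getElem?_append_left]
    · exact ih
    · rw [length_strategyRun]; omega

theorem getElem?_strategyRun {i t : ℕ} (h : i < t) :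
    (strategyRun F X p t).1[i]? = some (strategyRun F X p i).2.reply := by
  obtain ⟨s, rfl⟩ := Nat.exists_eq_add_of_le (Nat.succ_le_of_lt h)
  exact getElem?_strategyRun_succ i s

theorem strategyRun_read {t : ℕ} (h : (F (strategyRun F X p (t + 1)).1).1 = 0) :
    (strategyRun F X p (t + 1)).2.reply = p (strategyRun F X p t).2.head ∧
    (strategyRun F X p (t + 1)).2.head = (strategyRun F X p t).2.head + 1 ∧
    (strategyRun F X p (t + 1)).2.output = (strategyRun F X p t).2.output := by
  rw [strategyRun] at h ⊢
  rw [act_read (by simpa using h)]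
  exact ⟨rfl, rfl, rfl⟩

theorem strategyRun_ask {t : ℕ} (h : (F (strategyRun F X p (t + 1)).1).1 = 1) :
    (strategyRun F X p (t + 1)).2.reply = bit X (F (strategyRun F X p (t + 1)).1).2 ∧
    (strategyRun F X p (t + 1)).2.head = (strategyRun F X p t).2.head ∧
    (strategyRun F X p (t + 1)).2.output = (strategyRun F X p t).2.output := by
  rw [strategyRun] at h ⊢
  rw [act_ask (by simpa using h)]
  exact ⟨by simp, rfl, rfl⟩

theorem strategyRun_write {t : ℕ} (h : 2 ≤ (F (strategyRun F X p (t + 1)).1).1) :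
    (strategyRun F X p (t + 1)).2.head = (strategyRun F X p t).2.head ∧
    (strategyRun F X p (t + 1)).2.output =
      (strategyRun F X p t).2.output ++ [(F (strategyRun F X p (t + 1)).1).2] := by
  rw [strategyRun] at h ⊢
  rw [act_write (by simpa using h)]
  exact ⟨rfl, by simp⟩

end Strategy

/-! ### Copying the input tape into an oracle -/

/-- The graph of a sequence, as a set of natural numbers. -/
def graphSet (T : ℕ → ℕ) : Set ℕ := {y | T y.unpair.1 = y.unpair.2}

/-- Reads cell `j` of the tape and writes symbol `j`, in turns: first the number `c`, and then the
characteristic sequence of the graph of the tape. -/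
def copyStrategy (c : ℕ) (H : List ℕ) : ℕ × ℕ :=
  if H.length % 2 = 1 then (0, 0)
  else if H.length = 2 then (2, c)
  else if H[2 * (H.length / 2 - 2).unpair.1 + 1]? = some (H.length / 2 - 2).unpair.2 then (2, 1)
  else (2, 0)

theorem primrec_copyStrategy (c : ℕ) : Primrec (copyStrategy c) := by
  unfold copyStrategy
  refine Primrec.ite (by fun_prop) (by fun_prop) (Primrec.ite (by fun_prop) (by fun_prop)
    (Primrec.ite (by fun_prop) (by fun_prop) (by fun_prop)))

theorem strategyRun_copyStrategy (e' : Nat.Partrec.Code) (T : ℕ → ℕ) (j : ℕ) :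
    let C := (strategyRun (copyStrategy (Encodable.encode e')) ∅ T (2 * j)).2
    C.head = j ∧ C.output = (List.range j).map (functionTape (graphSet T) e') ∧
      ∀ i < j, (strategyRun (copyStrategy (Encodable.encode e')) ∅ T (2 * i + 1)).2.reply = T i := by
  set F := copyStrategy (Encodable.encode e') with hF
  induction j with
  | zero => simp [strategyRun, Config.init]
  | succ j ih =>
    obtain ⟨h1, h2, h3⟩ := ih
    have hr : (F (strategyRun F ∅ T (2 * j + 1)).1).1 = 0 := by
      rw [hF, copyStrategy, length_strategyRun, if_pos (by omega)]
    obtain ⟨r1, r2, r3⟩ := strategyRun_read hr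
    have hrep : ∀ i < j + 1, (strategyRun F ∅ T (2 * i + 1)).2.reply = T i := by
      intro i hi
      rcases Nat.lt_succ_iff_lt_or_eq.1 hi with hi | rfl
      · exact h3 i hi
      · rw [r1, h1]
    have hw : F (strategyRun F ∅ T (2 * j + 1 + 1)).1 =
        (2, functionTape (graphSet T) e' j) := by
      rw [hF, copyStrategy, length_strategyRun, if_neg (by omega)]
      cases j with
      | zero => rfl
      | succ j =>
        -- Symbol `j + 1` tests the pair coded by `j`, whose cell number is at most `j`; that cell
        -- has already been read.
        rw [if_neg (by omega), show (2 * (j + 1) + 1 + 1) / 2 - 2 = j by omega, ← hF,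
          getElem?_strategyRun, hrep]
        · simp only [functionTape, bit, graphSet, Set.mem_ofPred_eq, Option.some.injEq]
          split_ifs with h <;> simp [h]
        · have := Nat.unpair_left_le j
          omega
        · have := Nat.unpair_left_le j
          omega
    obtain ⟨w1, w2⟩ := strategyRun_write (F := F) (X := ∅) (p := T) (t := 2 * j + 1)
      (by rw [hw])
    rw [show 2 * (j + 1) = 2 * j + 1 + 1 by ring]
    refine ⟨by rw [w1, r2, h1], ?_, hrep⟩
    rw [w2, r3, h2, hw, List.range_succ, List.map_append]
    rfl

/-- A machine that turns a tape into the name consisting of a fixed machine and the graph of the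
tape. -/
theorem exists_copy_machine (e' : Nat.Partrec.Code) :
    ∃ M : Nat.Partrec.Code, ∀ T, Writes M ∅ T (functionTape (graphSet T) e') := by
  obtain ⟨M, hM⟩ := exists_code_eval_strategyProgram
    (primrec_copyStrategy (Encodable.encode e'))
  refine ⟨M, fun T n => ⟨2 * (n + 1), _, by rw [run_eq_strategyRun hM]; exact Part.mem_some _, ?_⟩⟩
  rw [(strategyRun_copyStrategy e' T (n + 1)).2.1]
  simp

/-! ### Enumerating by certificates -/

/-- Reads cell `s` of the input tape, asks the oracle about `s`, and writes the first component of
`s` if this is certified by the second component and the replies so far. -/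
noncomputable def searchStrategy (G : List ℕ × ℕ → Prop) (H : List ℕ) : ℕ × ℕ :=
  open Classical in
  if H.length % 3 = 1 then (0, 0)
  else if H.length % 3 = 2 then (1, H.length / 3)
  else if G (H, H.length / 3 - 1) then (2, (H.length / 3 - 1).unpair.1)
  -- Every step must perform an action; a failed test is spent on a question whose answer is
  -- ignored.
  else (1, 0)

theorem primrec_searchStrategy {G : List ℕ × ℕ → Prop} (hG : PrimrecPred G) :
    Primrec (searchStrategy G) := by
  classical
  unfold searchStrategy
  refine Primrec.ite (by fun_prop) (by fun_prop) (Primrec.ite (by fun_prop) (by fun_prop)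
    (Primrec.ite (hG.comp (by fun_prop)) (by fun_prop) (by fun_prop)))

theorem strategyRun_searchStrategy (G : List ℕ × ℕ → Prop) (Y : Set ℕ) (p : ℕ → ℕ) (s : ℕ) :
    (strategyRun (searchStrategy G) Y p (3 * s)).2.head = s ∧
      (strategyRun (searchStrategy G) Y p (3 * s + 1)).2.reply = p s ∧
      (strategyRun (searchStrategy G) Y p (3 * s + 2)).2.reply = bit Y s ∧
      (strategyRun (searchStrategy G) Y p (3 * s + 3)).2.output =
        (strategyRun (searchStrategy G) Y p (3 * s)).2.output ++
          open Classical in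
          if G ((strategyRun (searchStrategy G) Y p (3 * s + 3)).1, s) then [s.unpair.1] else [] := by
  classical
  set F := searchStrategy G with hF
  have key : ∀ s, (strategyRun F Y p (3 * s)).2.head = s →
      (strategyRun F Y p (3 * s + 1)).2.reply = p s ∧
      (strategyRun F Y p (3 * s + 2)).2.reply = bit Y s ∧
      (strategyRun F Y p (3 * s + 3)).2.output = (strategyRun F Y p (3 * s)).2.output ++
          (if G ((strategyRun F Y p (3 * s + 3)).1, s) then [s.unpair.1] else []) ∧
      (strategyRun F Y p (3 * s + 3)).2.head = s + 1 := by
    intro s hs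
    have hr : F (strategyRun F Y p (3 * s + 1)).1 = (0, 0) := by
      rw [hF, searchStrategy, length_strategyRun, if_pos (by omega)]
    obtain ⟨r1, r2, r3⟩ := strategyRun_read (congrArg Prod.fst hr)
    have ha : F (strategyRun F Y p (3 * s + 1 + 1)).1 = (1, s) := by
      rw [hF, searchStrategy, length_strategyRun, if_neg (by omega), if_pos (by omega),
        show (3 * s + 1 + 1) / 3 = s by omega]
    obtain ⟨a1, a2, a3⟩ := strategyRun_ask (congrArg Prod.fst ha)
    refine ⟨by rw [r1, hs], by rw [a1, ha], ?_⟩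
    have hw : F (strategyRun F Y p (3 * s + 2 + 1)).1 =
        if G ((strategyRun F Y p (3 * s + 3)).1, s) then (2, s.unpair.1) else (1, 0) := by
      rw [hF, searchStrategy, length_strategyRun, if_neg (by omega), if_neg (by omega),
        show (3 * s + 2 + 1) / 3 - 1 = s by omega]
    by_cases hG : G ((strategyRun F Y p (3 * s + 3)).1, s)
    · rw [if_pos hG] at hw ⊢
      obtain ⟨w1, w2⟩ := strategyRun_write (F := F) (X := Y) (p := p) (t := 3 * s + 2) (by rw [hw])
      exact ⟨by rw [w2, hw, a3, r3], by rw [w1, a2, r2, hs]⟩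
    · rw [if_neg hG] at hw ⊢
      obtain ⟨w0, w1, w2⟩ := strategyRun_ask (F := F) (X := Y) (p := p) (t := 3 * s + 2)
        (by rw [hw])
      exact ⟨by rw [w2, a3, r3, List.append_nil], by rw [w1, a2, r2, hs]⟩
  have head : ∀ s, (strategyRun F Y p (3 * s)).2.head = s := by
    intro s
    induction s with
    | zero => rfl
    | succ s ih => exact (key s ih).2.2.2
  exact ⟨head s, (key s (head s)).1, (key s (head s)).2.1, (key s (head s)).2.2.1⟩

/-- The list of replies `H` contains the information that `y` belongs to the oracle. -/
def KnowsOracle (H : List ℕ) (y : ℕ) : Prop := H[3 * y + 2]? = some 1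

/-- The list of replies `H` contains the information that cell `n` of the input is `x`. -/
def KnowsInput (H : List ℕ) (n x : ℕ) : Prop := H[3 * n + 1]? = some x

/-- `H` contains only correct information on the oracle `Y` and the input tape `p`. -/
structure Correct (H : List ℕ) (Y : Set ℕ) (p : ℕ → ℕ) : Prop where
  oracle : ∀ y, KnowsOracle H y → y ∈ Y
  input : ∀ n x, KnowsInput H n x → p n = x

/-- `H` contains all the information on the oracle `Y` and the input tape `p` up to `b`. -/
structure CompleteTo (H : List ℕ) (Y : Set ℕ) (p : ℕ → ℕ) (b : ℕ) : Prop where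
  oracle : ∀ y ≤ b, y ∈ Y → KnowsOracle H y
  input : ∀ n ≤ b, KnowsInput H n (p n)

/-- If the members of a set are those numbers that have a certificate, then a machine can
enumerate it from the oracle and the input tape. -/
theorem exists_search_machine {G : List ℕ × ℕ → Prop} (hG : PrimrecPred G) :
    ∃ e : Nat.Partrec.Code, ∀ (Y : Set ℕ) (p : ℕ → ℕ) (S : Set ℕ), S.Infinite →
      (∀ H s, Correct H Y p → G (H, s) → s.unpair.1 ∈ S) →
      (∀ k ∈ S, ∃ s, s.unpair.1 = k ∧ ∀ H, Correct H Y p → CompleteTo H Y p s → G (H, s)) →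
      ∃ q, Writes e Y p q ∧ ∀ k, (∃ i, q i = k) ↔ k ∈ S := by
  classical
  obtain ⟨e, he⟩ := exists_code_eval_strategyProgram (primrec_searchStrategy hG)
  refine ⟨e, fun Y p S hinf hsound hcomplete => ?_⟩
  set F := searchStrategy G
  have spec := strategyRun_searchStrategy G Y p
  set H : ℕ → List ℕ := fun s => (strategyRun F Y p (3 * s + 3)).1 with hH
  set O : ℕ → List ℕ := fun s => (strategyRun F Y p (3 * s)).2.output with hO
  have hO0 : O 0 = [] := rfl
  have hOs : ∀ s, O (s + 1) = O s ++ if G (H s, s) then [s.unpair.1] else [] :=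
    fun s => (spec s).2.2.2
  have hcorrect : ∀ s, Correct (H s) Y p := by
    refine fun s => ⟨fun y hy => ?_, fun n x hn => ?_⟩
    · have hlt : 3 * y + 2 < 3 * s + 3 := by
        have := (List.getElem?_eq_some_iff.1 hy).1
        rwa [hH, length_strategyRun] at this
      rw [KnowsOracle, hH, getElem?_strategyRun hlt, (spec y).2.2.1] at hy
      by_contra hny
      simp [bit, hny] at hy
    · have hlt : 3 * n + 1 < 3 * s + 3 := by
        have := (List.getElem?_eq_some_iff.1 hn).1
        rwa [hH, length_strategyRun] at this
      rw [KnowsInput, hH, getElem?_strategyRun hlt, (spec n).2.1] at hn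
      exact Option.some_injective _ hn
  have hcompl : ∀ s, CompleteTo (H s) Y p s := by
    refine fun s => ⟨fun y hy hyY => ?_, fun n hn => ?_⟩
    · rw [KnowsOracle, hH, getElem?_strategyRun (by omega), (spec y).2.2.1]
      simp [bit, hyY]
    · rw [KnowsInput, hH, getElem?_strategyRun (by omega), (spec n).2.1]
  have hmem : ∀ k, (∃ s, k ∈ O s) ↔ k ∈ S := by
    intro k
    constructor
    · rintro ⟨s, hs⟩
      induction s with
      | zero => simp [hO0] at hs
      | succ s ih =>
        rw [hOs, List.mem_append] at hs
        rcases hs with hs | hs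
        · exact ih hs
        · split_ifs at hs with hg
          · rw [List.mem_singleton.1 hs]
            exact hsound _ _ (hcorrect s) hg
          · simp at hs
    · intro hk
      obtain ⟨s, rfl, hs⟩ := hcomplete k hk
      refine ⟨s + 1, ?_⟩
      rw [hOs, if_pos (hs _ (hcorrect s) (hcompl s))]
      simp
  have hrun : ∀ t, (strategyRun F Y p t).2 ∈ run e Y p t := fun t => by
    rw [run_eq_strategyRun he]; exact Part.mem_some _
  have hpre : ∀ s d, O s <+: O (s + d) := by
    intro s d
    refine output_prefix_of_mem_run (hrun (3 * s)) (s := 3 * d) ?_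
    rw [← Nat.mul_add]
    exact hrun _
  obtain ⟨q, hq⟩ : ∃ q, Writes e Y p q := by
    apply exists_writes_of_length_unbounded
    by_contra! hcon
    obtain ⟨n, hn⟩ := hcon
    refine hinf ?_
    -- Each finite part of `S` appears in the output by some stage, so a bound on the output length
    -- would bound the cardinality of `S`.
    have hfin : ∀ A : Finset ℕ, (A : Set ℕ) ⊆ S → A.card ≤ n := by
      intro A hA
      obtain ⟨s, hs⟩ : ∃ s, ∀ k ∈ A, k ∈ O s := by
        induction A using Finset.induction_on with
        | empty => exact ⟨0, by simp⟩
        | insert a A _ ih =>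
          obtain ⟨s, hs⟩ := ih fun x hx => hA (by simp_all)
          obtain ⟨s', hs'⟩ := (hmem a).2 (hA (by simp))
          refine ⟨s + s', fun k hk => ?_⟩
          rcases Finset.mem_insert.1 hk with rfl | hk
          · rw [Nat.add_comm]; exact (hpre s' s).subset hs'
          · exact (hpre s s').subset (hs k hk)
      calc A.card ≤ (O s).toFinset.card :=
            Finset.card_le_card fun k hk => List.mem_toFinset.2 (hs k hk)
        _ ≤ (O s).length := List.toFinset_card_le _
        _ ≤ n := hn _ _ (hrun (3 * s))
    by_contra hS
    obtain ⟨A, hA, hcard⟩ := (show S.Infinite from hS).exists_subset_card_eq (n + 1)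
    have := hfin A hA
    omega
  refine ⟨q, hq, fun k => ?_⟩
  rw [← hmem]
  constructor
  · rintro ⟨n, rfl⟩
    obtain ⟨t, C, hC, hn⟩ := hq n
    -- Step `t` is no later than step `3t`, where stage `t` of the search begins.
    refine ⟨t, (output_prefix_of_mem_run (s := 2 * t) hC ?_).subset (List.mem_of_getElem? hn)⟩
    rw [show t + 2 * t = 3 * t by ring]
    exact hrun _
  · rintro ⟨s, hs⟩
    exact (hq.exists_eq_iff k).2 (exists_writesAt_of_mem_output (hrun (3 * s)) hs)

/-! ### Simulation of a machine on finite information -/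

/-- One step of the machine `e` with fuel `f` on the finite input `L` and the partial oracle `o`,
for a configuration (state, last reply, head). -/
def simStep (o : ℕ → Option ℕ) (L : List ℕ) (e : Nat.Partrec.Code) (f : ℕ) (C : ℕ × ℕ × ℕ) :
    Option (ℕ × ℕ × ℕ) :=
  (e.evaln f (Nat.pair C.1 C.2.1)).bind fun k =>
    if k.unpair.2.unpair.1 = 0 then (L[C.2.2]?).map fun r => (k.unpair.1, r, C.2.2 + 1)
    else if k.unpair.2.unpair.1 = 1 then
      (o k.unpair.2.unpair.2).map fun r => (k.unpair.1, r, C.2.2)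
    else some (k.unpair.1, 0, C.2.2)

/-- The configuration after `t` simulated steps. -/
def sim (o : ℕ → Option ℕ) (L : List ℕ) (e : Nat.Partrec.Code) (f t : ℕ) : Option (ℕ × ℕ × ℕ) :=
  Nat.rec (some (0, 0, 0)) (fun _ C => C.bind (simStep o L e f)) t

/-- The symbol written at step `t` of the simulation, if any. -/
def simOut (o : ℕ → Option ℕ) (L : List ℕ) (e : Nat.Partrec.Code) (f t : ℕ) : Option ℕ :=
  (sim o L e f t).bind fun C => (e.evaln f (Nat.pair C.1 C.2.1)).bind fun k =>
    if 2 ≤ k.unpair.2.unpair.1 then some k.unpair.2.unpair.2 else none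

section Simulation

variable {o : ℕ → Option ℕ} {L : List ℕ} {e : Nat.Partrec.Code} {X : Set ℕ} {p : ℕ → ℕ}

/-- A simulation that has not failed used only true replies and terminating evaluations, so it
follows the genuine run. The simulation forgets the output, whence the existential. -/
theorem exists_mem_run_of_sim {f t : ℕ} (ho : ∀ x r, o x = some r → bit X x = r)
    (hL : ∀ i x, L[i]? = some x → p i = x) {C : ℕ × ℕ × ℕ} (hC : sim o L e f t = some C) :
    ∃ out, (⟨C.1, C.2.1, C.2.2, out⟩ : Config) ∈ run e X p t := by
  induction t generalizing C with
  | zero =>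
    obtain rfl := Option.some_injective _ (show some (0, 0, 0) = some C from hC)
    exact ⟨[], Part.mem_some _⟩
  | succ t ih =>
    obtain ⟨B, hB, hBC⟩ := Option.bind_eq_some_iff.1 (show (sim o L e f t).bind _ = some C from hC)
    obtain ⟨out, hout⟩ := ih hB
    obtain ⟨k, hk, hkC⟩ := Option.bind_eq_some_iff.1 hBC
    refine ⟨(act X p ⟨B.1, B.2.1, B.2.2, out⟩ k).output, mem_run_succ.2
      ⟨_, hout, k, Nat.Partrec.Code.evaln_sound hk, ?_⟩⟩
    split_ifs at hkC with h0 h1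
    · obtain ⟨r, hr, rfl⟩ := Option.map_eq_some_iff.1 hkC
      simp [act_read h0, hL _ _ hr]
    · obtain ⟨r, hr, rfl⟩ := Option.map_eq_some_iff.1 hkC
      simp [act_ask h1, ho _ _ hr]
    · obtain rfl := Option.some_injective _ hkC
      simp [act_write (show 2 ≤ k.unpair.2.unpair.1 by omega)]

theorem writesAt_of_simOut {f t x : ℕ} (ho : ∀ x r, o x = some r → bit X x = r)
    (hL : ∀ i x, L[i]? = some x → p i = x) (hx : simOut o L e f t = some x) :
    WritesAt e X p t x := by
  obtain ⟨C, hC, hCx⟩ := Option.bind_eq_some_iff.1 hx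
  obtain ⟨k, hk, hkx⟩ := Option.bind_eq_some_iff.1 hCx
  obtain ⟨out, hout⟩ := exists_mem_run_of_sim ho hL hC
  split_ifs at hkx with h
  exact ⟨_, hout, k, Nat.Partrec.Code.evaln_sound hk, h, Option.some_injective _ hkx⟩

/-- The use principle: a finite run consults finitely many cells and oracle bits and needs finitely
much fuel. -/
theorem exists_forall_sim_eq {t : ℕ} {C : Config} (hC : C ∈ run e X p t) :
    ∃ b, ∀ (o : ℕ → Option ℕ) (L : List ℕ) (f : ℕ), b ≤ f →
      (∀ x < b, o x = some (bit X x)) → (∀ i < b, L[i]? = some (p i)) →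
      sim o L e f t = some (C.state, C.reply, C.head) := by
  induction t generalizing C with
  | zero =>
    simp only [run, Part.mem_some_iff] at hC
    subst hC
    exact ⟨0, fun _ _ _ _ _ _ => rfl⟩
  | succ t ih =>
    obtain ⟨B, hB, k, hk, rfl⟩ := mem_run_succ.1 hC
    obtain ⟨b, hb⟩ := ih hB
    obtain ⟨f₀, hf₀⟩ := Nat.Partrec.Code.evaln_complete.1 hk
    -- The bound covers the earlier steps, the fuel, the cell under the head and the possible oracle
    -- question.
    refine ⟨b + f₀ + B.head + 1 + k.unpair.2.unpair.2, fun o L f hf ho hL => ?_⟩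
    have hB' := hb o L f (by omega) (fun x hx => ho x (by omega)) (fun i hi => hL i (by omega))
    change (sim o L e f t).bind _ = _
    rw [hB', Option.bind_some, simStep,
      Option.mem_def.1 (Nat.Partrec.Code.evaln_mono (by omega : f₀ ≤ f) hf₀), Option.bind_some]
    split_ifs with h0 h1
    · rw [hL B.head (by omega), act_read h0]
      rfl
    · rw [ho k.unpair.2.unpair.2 (by omega), act_ask h1]
      rfl
    · rw [act_write (by omega)]

theorem exists_forall_simOut_eq {t x : ℕ} (h : WritesAt e X p t x) :
    ∃ b, ∀ (o : ℕ → Option ℕ) (L : List ℕ) (f : ℕ), b ≤ f →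
      (∀ x < b, o x = some (bit X x)) → (∀ i < b, L[i]? = some (p i)) →
      simOut o L e f t = some x := by
  obtain ⟨C, hC, k, hk, h2, hx⟩ := h
  obtain ⟨b, hb⟩ := exists_forall_sim_eq hC
  obtain ⟨f₀, hf₀⟩ := Nat.Partrec.Code.evaln_complete.1 hk
  refine ⟨b + f₀, fun o L f hf ho hL => ?_⟩
  rw [simOut, hb o L f (by omega) (fun x hx => ho x (by omega)) (fun i hi => hL i (by omega)),
    Option.bind_some, Option.mem_def.1 (Nat.Partrec.Code.evaln_mono (by omega : f₀ ≤ f) hf₀),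
    Option.bind_some, if_pos h2, hx]

end Simulation

/-- What the list of replies `H` tells about the oracle of the function name on the tape. -/
def knownOracle (H : List ℕ) (x : ℕ) : Option ℕ :=
  -- Bit `x` stands in cell `3x + 3`: every third cell belongs to the function name, whose first
  -- cell is the machine code. Only positive answers count as knowledge, so both values are tried.
  if H[3 * Nat.pair (3 * x + 3) 1 + 2]? = some 1 then some 1
  else if H[3 * Nat.pair (3 * x + 3) 0 + 2]? = some 1 then some 0 else none

section PrimrecSim

variable {α : Type*} [Primcodable α]

theorem primrec_knownOracle {H : α → List ℕ} {x : α → ℕ} (hH : Primrec H) (hx : Primrec x) :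
    Primrec fun a => knownOracle (H a) (x a) := by
  unfold knownOracle
  exact Primrec.ite (by fun_prop) (by fun_prop) (Primrec.ite (by fun_prop) (by fun_prop)
    (by fun_prop))

theorem primrec_option_bind {β γ : Type*} [Primcodable β] [Primcodable γ] {f : α → Option β}
    {g : α → β → Option γ} (hf : Primrec f) (hg : Primrec fun q : α × β => g q.1 q.2) :
    Primrec fun a => (f a).bind (g a) := Primrec.option_bind hf hg

theorem primrec_option_map {β γ : Type*} [Primcodable β] [Primcodable γ] {f : α → Option β}
    {g : α → β → γ} (hf : Primrec f) (hg : Primrec fun q : α × β => g q.1 q.2) :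
    Primrec fun a => (f a).map (g a) := Primrec.option_map hf hg

theorem primrec_simStep {H L : α → List ℕ} {e : α → Nat.Partrec.Code} {f : α → ℕ}
    {C : α → ℕ × ℕ × ℕ} (hH : Primrec H) (hL : Primrec L) (he : Primrec e) (hf : Primrec f)
    (hC : Primrec C) :
    Primrec fun a => simStep (knownOracle (H a)) (L a) (e a) (f a) (C a) := by
  unfold simStep
  apply primrec_option_bind
  · fun_prop
  apply Primrec.ite
  · fun_prop
  · apply primrec_option_map
    · fun_prop
    · fun_prop
  apply Primrec.ite
  · fun_prop
  · apply primrec_option_map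
    · apply primrec_knownOracle
      · fun_prop
      · fun_prop
    · fun_prop
  · fun_prop

theorem primrec_sim {H L : α → List ℕ} {e : α → Nat.Partrec.Code} {f t : α → ℕ}
    (hH : Primrec H) (hL : Primrec L) (he : Primrec e) (hf : Primrec f) (ht : Primrec t) :
    Primrec fun a => sim (knownOracle (H a)) (L a) (e a) (f a) (t a) := by
  refine Primrec.nat_rec' (g := fun _ => some (0, 0, 0))
    (h := fun a q => q.2.bind (simStep (knownOracle (H a)) (L a) (e a) (f a)))
    ht (by fun_prop) ?_
  apply primrec_option_bind
  · fun_prop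
  apply primrec_simStep
  all_goals fun_prop

theorem primrec_simOut {H L : α → List ℕ} {e : α → Nat.Partrec.Code} {f t : α → ℕ}
    (hH : Primrec H) (hL : Primrec L) (he : Primrec e) (hf : Primrec f) (ht : Primrec t) :
    Primrec fun a => simOut (knownOracle (H a)) (L a) (e a) (f a) (t a) := by
  unfold simOut
  apply primrec_option_bind
  · exact primrec_sim hH hL he hf ht
  apply primrec_option_bind
  · fun_prop
  apply Primrec.ite
  all_goals fun_prop

end PrimrecSim

/-! ### Ball arithmetic for polynomials -/

/-- Horner's scheme in ball arithmetic, for the polynomial with Gaussian rational coefficients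
coded by `P` and the disk with center `x + iy` and radius `r`: center and radius of a disk that
contains the values of the polynomial. -/
def hornerBall {K : Type*} [Field K] [LinearOrder K] (P : List (ℕ × ℕ)) (x y r : K) : K × K × K :=
  P.foldr (fun a s => ((ratOf a.1 : K) + (x * s.1 - y * s.2.1), (ratOf a.2 : K) +
    (x * s.2.1 + y * s.1), (|x| + |y| + r) * s.2.2 + (|s.1| + |s.2.1|) * r)) (0, 0, 0)

section HornerPrimrec

variable {α : Type*} [Primcodable α]

/-- The fold is performed on codes of the state. Codes of rationals are not unique, so the induction
compares only the values they denote. -/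
theorem ratPrimrec_hornerBall {P : α → List (ℕ × ℕ)} {x y r : α → ℚ} (hP : Primrec P)
    (hx : RatPrimrec x) (hy : RatPrimrec y) (hr : RatPrimrec r) :
    RatPrimrec (fun a => (hornerBall (P a) (x a) (y a) (r a)).1) ∧
    RatPrimrec (fun a => (hornerBall (P a) (x a) (y a) (r a)).2.1) ∧
    RatPrimrec (fun a => (hornerBall (P a) (x a) (y a) (r a)).2.2) := by
  obtain ⟨g₁, hg₁, h₁⟩ : RatPrimrec fun q : α × (ℕ × ℕ) × (ℕ × ℕ × ℕ) =>
      ratOf q.2.1.1 + (x q.1 * ratOf q.2.2.1 - y q.1 * ratOf q.2.2.2.1) := by fun_prop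
  obtain ⟨g₂, hg₂, h₂⟩ : RatPrimrec fun q : α × (ℕ × ℕ) × (ℕ × ℕ × ℕ) =>
      ratOf q.2.1.2 + (x q.1 * ratOf q.2.2.2.1 + y q.1 * ratOf q.2.2.1) := by fun_prop
  obtain ⟨g₃, hg₃, h₃⟩ : RatPrimrec fun q : α × (ℕ × ℕ) × (ℕ × ℕ × ℕ) =>
      (|x q.1| + |y q.1| + r q.1) * ratOf q.2.2.2.2
        + (|ratOf q.2.2.1| + |ratOf q.2.2.2.1|) * r q.1 := by fun_prop
  obtain ⟨z, hz⟩ := exists_ratOf_eq 0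
  set c : α → ℕ × ℕ × ℕ := fun a => (P a).foldr
    (fun b s => (g₁ (a, b, s), g₂ (a, b, s), g₃ (a, b, s))) (z, z, z) with hc
  have hcP : Primrec c := Primrec.list_foldr (h := fun a q => (g₁ (a, q), g₂ (a, q), g₃ (a, q)))
    hP (Primrec.const _) (show Primrec fun q : α × (ℕ × ℕ) × (ℕ × ℕ × ℕ) =>
      (g₁ (q.1, q.2), g₂ (q.1, q.2), g₃ (q.1, q.2)) by fun_prop)
  have key : ∀ a, (ratOf (c a).1, ratOf (c a).2.1, ratOf (c a).2.2)
      = hornerBall (P a) (x a) (y a) (r a) := by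
    intro a
    simp only [hc, hornerBall]
    induction P a with
    | nil => simp [hz]
    | cons b l ih =>
      simp only [List.foldr_cons, ← ih, h₁, h₂, h₃]
      simp
  exact ⟨⟨fun a => (c a).1, by fun_prop, fun a => congrArg (fun s => s.1) (key a)⟩,
    ⟨fun a => (c a).2.1, by fun_prop, fun a => congrArg (fun s => s.2.1) (key a)⟩,
    ⟨fun a => (c a).2.2, by fun_prop, fun a => congrArg (fun s => s.2.2) (key a)⟩⟩

theorem ratPrimrec_hornerBall_re {P : α → List (ℕ × ℕ)} {x y r : α → ℚ} (hP : Primrec P)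
    (hx : RatPrimrec x) (hy : RatPrimrec y) (hr : RatPrimrec r) :
    RatPrimrec (fun a => (hornerBall (P a) (x a) (y a) (r a)).1) :=
  (ratPrimrec_hornerBall hP hx hy hr).1

theorem ratPrimrec_hornerBall_im {P : α → List (ℕ × ℕ)} {x y r : α → ℚ} (hP : Primrec P)
    (hx : RatPrimrec x) (hy : RatPrimrec y) (hr : RatPrimrec r) :
    RatPrimrec (fun a => (hornerBall (P a) (x a) (y a) (r a)).2.1) :=
  (ratPrimrec_hornerBall hP hx hy hr).2.1

theorem ratPrimrec_hornerBall_rad {P : α → List (ℕ × ℕ)} {x y r : α → ℚ} (hP : Primrec P)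
    (hx : RatPrimrec x) (hy : RatPrimrec y) (hr : RatPrimrec r) :
    RatPrimrec (fun a => (hornerBall (P a) (x a) (y a) (r a)).2.2) :=
  (ratPrimrec_hornerBall hP hx hy hr).2.2

end HornerPrimrec

attribute [fun_prop] ratPrimrec_hornerBall_re ratPrimrec_hornerBall_im ratPrimrec_hornerBall_rad

/-! ### Certificates -/

/-- Left bound of the rectangle with index `k`. -/
def reLo (k : ℕ) : ℚ := ratOf k.unpair.2.unpair.1.unpair.1

/-- Right bound of the rectangle with index `k`. -/
def reHi (k : ℕ) : ℚ := ratOf k.unpair.2.unpair.1.unpair.2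

/-- Lower bound of the rectangle with index `k`. -/
def imLo (k : ℕ) : ℚ := ratOf k.unpair.2.unpair.2.unpair.1

/-- Upper bound of the rectangle with index `k`. -/
def imHi (k : ℕ) : ℚ := ratOf k.unpair.2.unpair.2.unpair.2

/-- Half of the perimeter of the rectangle with index `k`. -/
def halfPerimeter (k : ℕ) : ℚ := (reHi k - reLo k) + (imHi k - imLo k)

/-- Sufficient condition for the closed disk with center `x + iy` and radius `r` to be contained in
the basic set with index `k`. -/
def DiskIn {K : Type*} [Field K] [LinearOrder K] (x y r : K) (k : ℕ) : Prop :=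
  -- Squaring avoids the root in the distance from the origin, so the test is decidable over the
  -- rationals.
  (k.unpair.1 = 0 ∧ ((posRatOf k.unpair.2 : K) + r) ^ 2 < x ^ 2 + y ^ 2) ∨
  (k.unpair.1 ≠ 0 ∧ (reLo k : K) < x - r ∧ x + r < (reHi k : K) ∧ (imLo k : K) < y - r ∧
    y + r < (imHi k : K))

/-- Sufficient condition for the real interval `[a, b]` to be contained in the basic set with
index `k`. -/
def IntervalIn {K : Type*} [Field K] [LinearOrder K] (a b : K) (k : ℕ) : Prop :=
  (k.unpair.1 = 0 ∧ ((posRatOf k.unpair.2 : K) < a ∨ b < -(posRatOf k.unpair.2 : K))) ∨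
  (k.unpair.1 ≠ 0 ∧ (reLo k : K) < a ∧ b < (reHi k : K) ∧ (imLo k : K) < 0 ∧ 0 < (imHi k : K))

/-- `w` codes a finite list of basic sets that contain the disk about `x + iy` of radius `r`, and a
computation of `e` on this list which shows that the real part of the polynomial `P` differs by at
most `ε` from the function named by `e` on the disk. -/
def CellCert (H : List ℕ) (e : Nat.Partrec.Code) (P : List (ℕ × ℕ)) (ε x y r : ℚ) (w : ℕ) : Prop :=
  -- The components are the list of basic sets, the index that is output, the fuel, and the step at
  -- which it is output.
  let q := Denumerable.ofNat (List ℕ × ℕ × ℕ × ℕ) w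
  (∀ k ∈ q.1, DiskIn x y r k) ∧
  simOut (knownOracle H) q.1 e q.2.2.1 q.2.2.2 = some q.2.1 ∧ q.2.1.unpair.1 ≠ 0 ∧
  (hornerBall P x y r).1 + (hornerBall P x y r).2.2 - reLo q.2.1 ≤ ε ∧
  reHi q.2.1 - ((hornerBall P x y r).1 - (hornerBall P x y r).2.2) ≤ ε

/-- The closed disk of radius `S` about `x₀ + iy₀` is covered by disks of radius `2h` about points
of a grid that have cell certificates. -/
def CoverCert (H : List ℕ) (b : ℕ) (e : Nat.Partrec.Code) (P : List (ℕ × ℕ)) (ε x₀ y₀ S h : ℚ)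
    (N : ℕ) : Prop :=
  S ≤ N * h ∧ ∀ i < 2 * N + 1, ∀ j < 2 * N + 1,
    (S + 2 * h) ^ 2 < (h * ((i : ℚ) - N)) ^ 2 + (h * ((j : ℚ) - N)) ^ 2 ∨
    ∃ w < b, CellCert H e P ε (x₀ + h * ((i : ℚ) - N)) (y₀ + h * ((j : ℚ) - N)) (2 * h) w

/-- Certificate for the value of the conjugate function to lie in the basic set with index `k`. -/
def ValueCert (H : List ℕ) (b k c i₀ k₀ iR kR i₁ k₁ : ℕ) (P : List (ℕ × ℕ)) (ρ σ ε τ h : ℚ)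
    (N : ℕ) : Prop :=
  (KnowsOracle H (Nat.pair 0 c) ∧ KnowsOracle H (Nat.pair (3 * i₀ + 1) k₀) ∧
    KnowsOracle H (Nat.pair (3 * iR + 2) kR) ∧ KnowsInput H i₁ k₁) ∧
  (k₀.unpair.1 ≠ 0 ∧ kR.unpair.1 ≠ 0 ∧ k₁.unpair.1 ≠ 0) ∧
  -- Corners of the rectangles stand for `z₀`, `z` and `R`; for the first two the error is at most
  -- the half perimeter. Thus `σ` plus two half perimeters bounds `|z - z₀|`, and the last
  -- inequality makes the Borel–Carathéodory error at most `τ`.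
  (0 < ε ∧ 0 ≤ σ ∧ 0 < h ∧ ρ + 2 * halfPerimeter k₀ ≤ reLo kR ∧
    (reLo k₁ - reLo k₀) ^ 2 + (imLo k₁ - imLo k₀) ^ 2 ≤ σ ^ 2 ∧
    σ + halfPerimeter k₀ + halfPerimeter k₁ < ρ ∧
    4 * ε * ρ ≤ τ * (ρ - σ - halfPerimeter k₀ - halfPerimeter k₁)) ∧
  CoverCert H b (Denumerable.ofNat Nat.Partrec.Code c) P ε (reLo k₀) (imLo k₀)
    (ρ + halfPerimeter k₀) h N ∧
  IntervalIn
    ((hornerBall P (reLo k₁) (imLo k₁) (halfPerimeter k₁)).2.1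
      - (hornerBall P (reLo k₀) (imLo k₀) (halfPerimeter k₀)).2.1
      - ((hornerBall P (reLo k₁) (imLo k₁) (halfPerimeter k₁)).2.2
        + (hornerBall P (reLo k₀) (imLo k₀) (halfPerimeter k₀)).2.2 + τ))
    ((hornerBall P (reLo k₁) (imLo k₁) (halfPerimeter k₁)).2.1
      - (hornerBall P (reLo k₀) (imLo k₀) (halfPerimeter k₀)).2.1
      + ((hornerBall P (reLo k₁) (imLo k₁) (halfPerimeter k₁)).2.2
        + (hornerBall P (reLo k₀) (imLo k₀) (halfPerimeter k₀)).2.2 + τ)) k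

/-- The data of a certificate other than the basic set: the code of the machine, the positions and
the indices of three basic sets, a polynomial, five rational numbers, and the size of a grid. -/
abbrev CertData : Type :=
  ℕ × (ℕ × ℕ) × (ℕ × ℕ) × (ℕ × ℕ) × List (ℕ × ℕ) × (ℕ × ℕ × ℕ × ℕ × ℕ) × ℕ

/-- The second component of `q.2` codes a certificate for the first component. -/
def Certified (q : List ℕ × ℕ) : Prop :=
  let c := Denumerable.ofNat CertData q.2.unpair.2.unpair.1
  ValueCert q.1 q.2.unpair.2.unpair.2 q.2.unpair.1 c.1 c.2.1.1 c.2.1.2 c.2.2.1.1 c.2.2.1.2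
    c.2.2.2.1.1 c.2.2.2.1.2 c.2.2.2.2.1 (ratOf c.2.2.2.2.2.1.1) (ratOf c.2.2.2.2.2.1.2.1)
    (ratOf c.2.2.2.2.2.1.2.2.1) (ratOf c.2.2.2.2.2.1.2.2.2.1) (ratOf c.2.2.2.2.2.1.2.2.2.2)
    c.2.2.2.2.2.2

section CertPrimrec

variable {α : Type*} [Primcodable α]

@[fun_prop]
theorem ratPrimrec_reLo {f : α → ℕ} (hf : Primrec f) : RatPrimrec fun a => reLo (f a) := by
  unfold reLo; fun_prop

@[fun_prop]
theorem ratPrimrec_reHi {f : α → ℕ} (hf : Primrec f) : RatPrimrec fun a => reHi (f a) := by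
  unfold reHi; fun_prop

@[fun_prop]
theorem ratPrimrec_imLo {f : α → ℕ} (hf : Primrec f) : RatPrimrec fun a => imLo (f a) := by
  unfold imLo; fun_prop

@[fun_prop]
theorem ratPrimrec_imHi {f : α → ℕ} (hf : Primrec f) : RatPrimrec fun a => imHi (f a) := by
  unfold imHi; fun_prop

@[fun_prop]
theorem ratPrimrec_halfPerimeter {f : α → ℕ} (hf : Primrec f) :
    RatPrimrec fun a => halfPerimeter (f a) := by
  unfold halfPerimeter; fun_prop

theorem primrecPred_diskIn {x y r : α → ℚ} {k : α → ℕ} (hx : RatPrimrec x) (hy : RatPrimrec y)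
    (hr : RatPrimrec r) (hk : Primrec k) : PrimrecPred fun a => DiskIn (x a) (y a) (r a) (k a) := by
  unfold DiskIn
  simp only [Rat.cast_id]
  fun_prop

theorem primrecPred_intervalIn {x y : α → ℚ} {k : α → ℕ} (hx : RatPrimrec x) (hy : RatPrimrec y)
    (hk : Primrec k) : PrimrecPred fun a => IntervalIn (x a) (y a) (k a) := by
  unfold IntervalIn
  simp only [Rat.cast_id]
  fun_prop

theorem primrecPred_cellCert {H : α → List ℕ} {e : α → Nat.Partrec.Code} {P : α → List (ℕ × ℕ)}
    {ε x y r : α → ℚ} {w : α → ℕ} (hH : Primrec H) (he : Primrec e) (hP : Primrec P)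
    (hε : RatPrimrec ε) (hx : RatPrimrec x) (hy : RatPrimrec y) (hr : RatPrimrec r)
    (hw : Primrec w) :
    PrimrecPred fun a => CellCert (H a) (e a) (P a) (ε a) (x a) (y a) (r a) (w a) := by
  unfold CellCert
  refine PrimrecPred.and ?_ (PrimrecPred.and ?_ (PrimrecPred.and ?_ (PrimrecPred.and ?_ ?_)))
  · apply primrecPred_forall_mem
    · fun_prop
    · apply primrecPred_diskIn <;> fun_prop
  · apply primrecPred_eq
    · apply primrec_simOut <;> fun_prop
    · fun_prop
  all_goals fun_prop

theorem primrecPred_coverCert {H : α → List ℕ} {b N : α → ℕ} {e : α → Nat.Partrec.Code}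
    {P : α → List (ℕ × ℕ)} {ε x y S h : α → ℚ} (hH : Primrec H) (hb : Primrec b) (he : Primrec e)
    (hP : Primrec P) (hε : RatPrimrec ε) (hx : RatPrimrec x) (hy : RatPrimrec y)
    (hS : RatPrimrec S) (hh : RatPrimrec h) (hN : Primrec N) :
    PrimrecPred fun a =>
      CoverCert (H a) (b a) (e a) (P a) (ε a) (x a) (y a) (S a) (h a) (N a) := by
  unfold CoverCert
  apply PrimrecPred.and
  · fun_prop
  apply primrecPred_forall_lt
  · fun_prop
  apply primrecPred_forall_lt
  · fun_prop
  apply PrimrecPred.or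
  · fun_prop
  apply primrecPred_exists_lt
  · fun_prop
  apply primrecPred_cellCert <;> fun_prop

theorem primrecPred_valueCert {H : α → List ℕ} {b k c i₀ k₀ iR kR i₁ k₁ N : α → ℕ}
    {P : α → List (ℕ × ℕ)} {ρ σ ε τ h : α → ℚ} (hH : Primrec H) (hb : Primrec b) (hk : Primrec k)
    (hc : Primrec c) (hi₀ : Primrec i₀) (hk₀ : Primrec k₀) (hiR : Primrec iR) (hkR : Primrec kR)
    (hi₁ : Primrec i₁) (hk₁ : Primrec k₁) (hP : Primrec P) (hρ : RatPrimrec ρ)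
    (hσ : RatPrimrec σ) (hε : RatPrimrec ε) (hτ : RatPrimrec τ) (hh : RatPrimrec h)
    (hN : Primrec N) :
    PrimrecPred fun a => ValueCert (H a) (b a) (k a) (c a) (i₀ a) (k₀ a) (iR a) (kR a) (i₁ a)
      (k₁ a) (P a) (ρ a) (σ a) (ε a) (τ a) (h a) (N a) := by
  unfold ValueCert KnowsOracle KnowsInput
  refine PrimrecPred.and ?_ (PrimrecPred.and ?_ (PrimrecPred.and ?_ (PrimrecPred.and ?_ ?_)))
  · fun_prop
  · fun_prop
  · fun_prop
  · apply primrecPred_coverCert <;> fun_prop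
  · apply primrecPred_intervalIn <;> fun_prop

theorem primrecPred_certified : PrimrecPred Certified := by
  unfold Certified
  apply primrecPred_valueCert <;> fun_prop

end CertPrimrec

/-! ### Polynomials with Gaussian rational coefficients -/

/-- The Gaussian rational number with code `a`. -/
noncomputable def gaussOf (a : ℕ × ℕ) : ℂ := ⟨(ratOf a.1 : ℝ), (ratOf a.2 : ℝ)⟩

/-- The value at `w` of the polynomial with the coefficients coded by `P`. -/
noncomputable def polyEval (P : List (ℕ × ℕ)) (w : ℂ) : ℂ :=
  P.foldr (fun a s => gaussOf a + w * s) 0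

theorem polyEval_cons (a : ℕ × ℕ) (P : List (ℕ × ℕ)) (w : ℂ) :
    polyEval (a :: P) w = gaussOf a + w * polyEval P w := rfl

theorem hornerBall_cons {K : Type*} [Field K] [LinearOrder K] (a : ℕ × ℕ) (P : List (ℕ × ℕ))
    (x y r : K) : hornerBall (a :: P) x y r =
      ((ratOf a.1 : K) + (x * (hornerBall P x y r).1 - y * (hornerBall P x y r).2.1),
        (ratOf a.2 : K) + (x * (hornerBall P x y r).2.1 + y * (hornerBall P x y r).1),
        (|x| + |y| + r) * (hornerBall P x y r).2.2
          + (|(hornerBall P x y r).1| + |(hornerBall P x y r).2.1|) * r) := rfl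

/-- The recursion is generic in the field for this reason: the machine runs it over `ℚ`, while
continuity is studied over `ℝ`. -/
theorem hornerBall_cast (P : List (ℕ × ℕ)) (x y r : ℚ) :
    hornerBall P (x : ℝ) (y : ℝ) (r : ℝ) = (((hornerBall P x y r).1 : ℝ),
      ((hornerBall P x y r).2.1 : ℝ), ((hornerBall P x y r).2.2 : ℝ)) := by
  induction P with
  | nil => simp [hornerBall]
  | cons a P ih =>
    rw [hornerBall_cons, hornerBall_cons, ih]
    simp

theorem hornerBall_center (P : List (ℕ × ℕ)) (x y r : ℝ) :
    (⟨(hornerBall P x y r).1, (hornerBall P x y r).2.1⟩ : ℂ) = polyEval P ⟨x, y⟩ := by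
  induction P with
  | nil => rfl
  | cons a P ih =>
    rw [hornerBall_cons, polyEval_cons, ← ih, gaussOf]
    apply Complex.ext <;> simp

theorem norm_polyEval_sub_le (P : List (ℕ × ℕ)) {x y r : ℝ} {w : ℂ} (h : ‖w - ⟨x, y⟩‖ ≤ r) :
    ‖polyEval P w - polyEval P ⟨x, y⟩‖ ≤ (hornerBall P x y r).2.2 := by
  induction P with
  | nil => simp [polyEval, hornerBall]
  | cons a P ih =>
    have hr : 0 ≤ r := (norm_nonneg _).trans h
    have hc : ‖polyEval P ⟨x, y⟩‖ ≤ |(hornerBall P x y r).1| + |(hornerBall P x y r).2.1| := by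
      rw [← hornerBall_center P x y r]
      exact Complex.norm_le_abs_re_add_abs_im _
    have hxy : ‖(⟨x, y⟩ : ℂ)‖ ≤ |x| + |y| := Complex.norm_le_abs_re_add_abs_im _
    rw [polyEval_cons, polyEval_cons, hornerBall_cons]
    set A := polyEval P w
    set B := polyEval P ⟨x, y⟩
    -- The three products match the three contributions to the radius in the recursion.
    have e : gaussOf a + w * A - (gaussOf a + ⟨x, y⟩ * B)
        = (w - ⟨x, y⟩) * (A - B) + ⟨x, y⟩ * (A - B) + (w - ⟨x, y⟩) * B := by ring
    rw [e]
    calc _ ≤ ‖w - ⟨x, y⟩‖ * ‖A - B‖ + ‖(⟨x, y⟩ : ℂ)‖ * ‖A - B‖ + ‖w - ⟨x, y⟩‖ * ‖B‖ := by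
          refine (norm_add_le _ _).trans (add_le_add ((norm_add_le _ _).trans ?_) ?_)
          · rw [norm_mul, norm_mul]
          · rw [norm_mul]
      _ ≤ r * (hornerBall P x y r).2.2 + (|x| + |y|) * (hornerBall P x y r).2.2
          + r * (|(hornerBall P x y r).1| + |(hornerBall P x y r).2.1|) := by gcongr
      _ = _ := by ring

/-- With `hornerBall_radius_zero`, this makes the enclosures arbitrarily tight on small disks, as
completeness requires. -/
theorem continuous_hornerBall (P : List (ℕ × ℕ)) :
    Continuous fun q : ℝ × ℝ × ℝ => hornerBall P q.1 q.2.1 q.2.2 := by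
  induction P with
  | nil => exact continuous_const
  | cons a P ih =>
    simp only [hornerBall_cons]
    fun_prop

theorem hornerBall_radius_zero (P : List (ℕ × ℕ)) (x y : ℝ) : (hornerBall P x y 0).2.2 = 0 := by
  induction P with
  | nil => rfl
  | cons a P ih => simp [hornerBall_cons, ih]

theorem differentiable_polyEval (P : List (ℕ × ℕ)) : Differentiable ℂ (polyEval P) := by
  induction P with
  | nil => exact differentiable_const 0
  | cons a P ih =>
    change Differentiable ℂ fun w => gaussOf a + w * polyEval P w
    fun_prop

theorem exists_gaussOf_near (a : ℂ) {ε : ℝ} (hε : 0 < ε) : ∃ c, ‖a - gaussOf c‖ < ε := by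
  obtain ⟨x, hx⟩ := exists_rat_btwn (show a.re - ε / 2 < a.re by linarith)
  obtain ⟨y, hy⟩ := exists_rat_btwn (show a.im - ε / 2 < a.im by linarith)
  obtain ⟨i, rfl⟩ := exists_ratOf_eq x
  obtain ⟨j, rfl⟩ := exists_ratOf_eq y
  refine ⟨(i, j), (Complex.norm_le_abs_re_add_abs_im _).trans_lt ?_⟩
  simp only [gaussOf, sub_re, sub_im]
  rw [abs_of_pos (by linarith), abs_of_pos (by linarith)]
  linarith

/-- Induction on the degree through `f = f(0) + X · divX f`. The tolerance for the quotient is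
divided by `|B| + 1`, since its error gets multiplied by `w`. -/
theorem exists_polyEval_near_polynomial (f : Polynomial ℂ) (B : ℝ) {ε : ℝ} (hε : 0 < ε) :
    ∃ P, ∀ w : ℂ, ‖w‖ ≤ B → ‖f.eval w - polyEval P w‖ < ε := by
  induction hn : f.natDegree using Nat.strong_induction_on generalizing f ε with
  | _ n ih =>
    rcases Nat.eq_zero_or_pos n with rfl | hpos
    · obtain ⟨c, hc⟩ := exists_gaussOf_near (f.coeff 0) hε
      refine ⟨[c], fun w _ => ?_⟩
      rw [Polynomial.eq_C_of_natDegree_eq_zero hn]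
      simpa [polyEval] using hc
    · have hB : 0 < |B| + 1 := by positivity
      obtain ⟨c, hc⟩ := exists_gaussOf_near (f.coeff 0) (half_pos hε)
      obtain ⟨P, hP⟩ := ih f.divX.natDegree
        (by rw [Polynomial.natDegree_divX_eq_natDegree_tsub_one]; omega) f.divX
        (ε := ε / 2 / (|B| + 1)) (by positivity) rfl
      refine ⟨c :: P, fun w hw => ?_⟩
      have e : f.eval w = f.coeff 0 + w * f.divX.eval w := by
        conv_lhs => rw [← Polynomial.divX_mul_X_add f]
        simp
        ring
      rw [e, polyEval_cons, add_sub_add_comm, ← mul_sub]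
      calc _ ≤ ‖f.coeff 0 - gaussOf c‖ + ‖w‖ * ‖f.divX.eval w - polyEval P w‖ := by
            refine (norm_add_le _ _).trans_eq ?_
            rw [norm_mul]
        _ < ε / 2 + (|B| + 1) * (ε / 2 / (|B| + 1)) := by
            refine add_lt_add_of_lt_of_le hc ?_
            exact mul_le_mul (hw.trans ((le_abs_self B).trans (by linarith))) (hP w hw).le
              (norm_nonneg _) hB.le
        _ = ε := by field_simp; ring

/-- Uniform approximation of a holomorphic function on a disk by polynomials with Gaussian rational
coefficients. -/
theorem exists_polyEval_near {F : ℂ → ℂ} {c : ℂ} {R R' : ℝ} (hR : 0 < R) (hRR' : R < R')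
    (hF : DifferentiableOn ℂ F (Metric.ball c R')) {ε : ℝ} (hε : 0 < ε) :
    ∃ P, ∀ w ∈ Metric.closedBall c R, ‖F w - polyEval P w‖ < ε := by
  -- Radii `R < R₂ < R₁ < R'`: the Cauchy series is taken on radius `R₁` and converges uniformly on
  -- the ball of radius `R₂`, which contains the closed disk.
  obtain ⟨R₁, h1, h2⟩ := exists_between hRR'
  obtain ⟨R₂, h3, h4⟩ := exists_between h1
  lift R₁ to NNReal using (hR.trans h1).le
  lift R₂ to NNReal using (hR.trans h3).le
  have hps := (hF.mono (Metric.closedBall_subset_ball h2)).hasFPowerSeriesOnBall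
    (hR.trans h1)
  have hlim := hps.tendstoUniformlyOn' (r' := R₂) (by exact_mod_cast h4)
  obtain ⟨n, hn⟩ := (Metric.tendstoUniformlyOn_iff.1 hlim (ε / 2) (half_pos hε)).exists
  set p := cauchyPowerSeries F c R₁
  set f : Polynomial ℂ := ∑ k ∈ Finset.range n,
    Polynomial.C (p.coeff k) * (Polynomial.X - Polynomial.C c) ^ k with hf
  obtain ⟨P, hP⟩ := exists_polyEval_near_polynomial f (‖c‖ + R) (half_pos hε)
  refine ⟨P, fun w hw => ?_⟩
  have hw' : ‖w - c‖ ≤ R := by simpa [dist_eq_norm] using hw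
  have e : f.eval w = p.partialSum n (w - c) := by
    simp [hf, Polynomial.eval_finsetSum, FormalMultilinearSeries.partialSum, mul_comm]
  have h5 : ‖F w - f.eval w‖ < ε / 2 := by
    rw [e, ← dist_eq_norm]
    exact hn w (by rw [Metric.mem_ball, dist_eq_norm]; linarith)
  have h6 := hP w (by
    calc ‖w‖ = ‖c + (w - c)‖ := by congr 1; ring
      _ ≤ ‖c‖ + R := (norm_add_le _ _).trans (by linarith))
  calc ‖F w - polyEval P w‖ = ‖(F w - f.eval w) + (f.eval w - polyEval P w)‖ := by congr 1; ring
    _ < ε := (norm_add_le _ _).trans_lt (by linarith)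

/-! ### Conjugate functions -/

/-- If the real part of a holomorphic function is small on a disk, then so is the oscillation of
the imaginary part in a smaller disk. -/
theorem abs_im_sub_im_le {f : ℂ → ℂ} {c z : ℂ} {ρ ε : ℝ} (hε : 0 < ε)
    (hf : DifferentiableOn ℂ f (Metric.ball c ρ))
    (hre : ∀ w ∈ Metric.ball c ρ, |(f w).re| ≤ ε) (hz : z ∈ Metric.ball c ρ) :
    |(f z).im - (f c).im| ≤ 4 * ε * ‖z - c‖ / (ρ - ‖z - c‖) := by
  have hρ : 0 < ρ := Metric.pos_of_mem_ball hz
  have hmaps : Set.MapsTo (fun w : ℂ => w + c) (Metric.ball 0 ρ) (Metric.ball c ρ) := by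
    intro w hw
    simpa [dist_eq_norm] using hw
  -- After subtracting `f c`, the function vanishes at the center and its real part is at most `2ε`;
  -- this gives the constant `4ε`.
  have key := Complex.borelCaratheodory_zero (f := fun w => f (w + c) - f c) (M := 2 * ε) (R := ρ)
    (z := z - c) (by linarith)
    ((hf.comp (by fun_prop) hmaps).sub_const _) ?_ hρ
    (by simpa [dist_eq_norm] using hz) (by simp)
  · simp only [sub_add_cancel] at key
    calc |(f z).im - (f c).im| = |(f z - f c).im| := by rw [sub_im]
      _ ≤ ‖f z - f c‖ := Complex.abs_im_le_norm _
      _ ≤ _ := key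
      _ = _ := by ring
  · intro w hw
    have h1 := abs_le.1 (hre _ (hmaps hw))
    have h2 := abs_le.1 (hre c (Metric.mem_ball_self hρ))
    simp only [Set.mem_ofPred_eq, sub_re]
    linarith

/-- Multiply `(ζ + w) / (ζ - w)` out with the conjugate denominator: the numerator becomes `|ζ|² -
|w|²` plus the purely imaginary `ζ̄ w - ζ w̄`. -/
theorem im_herglotzRieszKernel (w ζ : ℂ) :
    ((herglotzRieszKernel 0 w ζ).im : ℂ) =
      (1 / I) * ((starRingEnd ℂ ζ * w - ζ * starRingEnd ℂ w) / ((‖ζ - w‖ : ℝ) : ℂ) ^ 2) := by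
  have hI : (1 / I : ℂ) = -I := by simp
  rw [herglotzRieszKernel_def, sub_zero, sub_zero, hI, ← Complex.ofReal_pow, Complex.sq_norm]
  apply Complex.ext
  · simp [Complex.div_im, Complex.div_re, Complex.mul_re, Complex.normSq_apply]
    ring
  · simp [Complex.div_im, Complex.div_re, Complex.mul_re, Complex.normSq_apply]

/-- The imaginary part of a holomorphic function is, up to a constant, the conjugate Poisson
integral of the real part. -/
theorem im_sub_im_eq_conjugatePoisson {F : ℂ → ℂ} {u : ℂ → ℝ} {z₀ z : ℂ} {r R : ℝ}
    (hF : AnalyticOnNhd ℂ F (Metric.ball z₀ R)) (hu : ∀ w ∈ Metric.ball z₀ R, u w = (F w).re)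
    (hz : ‖z - z₀‖ < r) (hrR : r < R) :
    (((F z).im - (F z₀).im : ℝ) : ℂ) = conjugatePoisson u z₀ r z := by
  have hr : 0 < r := (norm_nonneg _).trans_lt hz
  set Φ : ℂ → ℂ := fun ζ => F (z₀ + ζ) with hΦ
  have hmem : ∀ ζ ∈ Metric.closedBall (0 : ℂ) r, z₀ + ζ ∈ Metric.ball z₀ R := by
    intro ζ hζ
    rw [mem_closedBall_zero_iff] at hζ
    rw [Metric.mem_ball, dist_eq_norm, add_sub_cancel_left]
    linarith
  have hΦan : AnalyticOnNhd ℂ Φ (Metric.closedBall 0 r) := fun ζ hζ =>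
    (hF _ (hmem ζ hζ)).comp_of_eq (by fun_prop) rfl
  set g : ℂ → ℝ := fun ζ => (Φ ζ).re with hg
  have hgharm : HarmonicOnNhd g (Metric.closedBall 0 r) := fun ζ hζ => (hΦan ζ hζ).harmonicAt_re
  have hgc : ContinuousOn g (Metric.sphere 0 |r|) := by
    rw [abs_of_pos hr]
    exact Complex.continuous_re.comp_continuousOn
      (hΦan.continuousOn.mono Metric.sphere_subset_closedBall)
  have hgint : CircleIntegrable g 0 r := hgc.circleIntegrable'
  have hgC : ContinuousOn (fun ζ => (g ζ : ℂ)) (Metric.sphere 0 |r|) :=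
    Complex.continuous_ofReal.comp_continuousOn hgc
  -- The Herglotz integral of the boundary values of `Re Φ`; by Poisson's formula it has the same
  -- real part as `Φ`.
  set h : ℂ → ℂ := fun w =>
    Real.circleAverage (fun ζ => herglotzRieszKernel 0 w ζ • (g ζ : ℂ)) 0 r with hh
  have hhd : DifferentiableOn ℂ h (Metric.ball 0 r) :=
    differentiableOn_circleAverage_herglotzRieszKernel_smul hgC.circleIntegrable'
  have hhre : ∀ w ∈ Metric.ball (0 : ℂ) r, (h w).re = g w := fun w hw => by
    rw [hh, re_circleAverage_herglotzRieszKernel_smul hgint hw]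
    exact hgharm.circleAverage_re_herglotzRieszKernel_smul hw
  have hhim : ∀ w ∈ Metric.ball (0 : ℂ) r, (h w).im =
      Real.circleAverage (fun ζ => (herglotzRieszKernel 0 w ζ).im * g ζ) 0 r := fun w hw => by
    have hint : CircleIntegrable (fun ζ => herglotzRieszKernel 0 w ζ • (g ζ : ℂ)) 0 r :=
      ((continuousOn_herglotzRieszKernel_sphere hw).smul hgC).circleIntegrable'
    have := Complex.imCLM.circleAverage_comp_comm hint
    rw [hh]
    refine this.symm.trans ?_
    congr 1
    ext ζ
    simp
  -- At `w = 0` the kernel is `ζ / ζ`, which is real, also at `ζ = 0` where the quotient is `0` by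
  -- convention.
  have hh0 : (h 0).im = 0 := by
    rw [hhim 0 (Metric.mem_ball_self hr)]
    have : ∀ ζ : ℂ, (herglotzRieszKernel 0 0 ζ).im * g ζ = 0 := by
      intro ζ
      rcases eq_or_ne ζ 0 with rfl | hζ
      · simp [herglotzRieszKernel_def]
      · simp [herglotzRieszKernel_def, div_self hζ]
    simp [this, Real.circleAverage_def]
  set w := z - z₀ with hw
  have hwb : w ∈ Metric.ball (0 : ℂ) r := by simpa using hz
  have himeq : (Φ w).im - (Φ 0).im = (h w).im := by
    -- The real part of `Φ - h` vanishes, so the estimate holds for every `ε`; letting `ε → 0` shows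
    -- that the imaginary part is constant.
    have hle : ∀ ε > 0, |(Φ w - h w).im - (Φ 0 - h 0).im| ≤ 4 * ε * ‖w‖ / (r - ‖w‖) := by
      intro ε hε
      have := abs_im_sub_im_le (f := fun ζ => Φ ζ - h ζ) (c := 0) (z := w) (ρ := r) hε
        ((hΦan.differentiableOn.mono Metric.ball_subset_closedBall).sub hhd) (fun ζ hζ => by
          simp [hhre ζ hζ, hg, hε.le]) hwb
      simpa using this
    have hlim : Filter.Tendsto (fun ε : ℝ => 4 * ε * ‖w‖ / (r - ‖w‖)) (nhdsWithin 0 (Set.Ioi 0))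
        (nhds (4 * 0 * ‖w‖ / (r - ‖w‖))) := by
      apply Filter.Tendsto.mono_left _ nhdsWithin_le_nhds
      exact Continuous.tendsto (by fun_prop) 0
    have h0 := ge_of_tendsto hlim (Filter.eventually_of_mem self_mem_nhdsWithin hle)
    have h1 := abs_nonpos_iff.1 (h0.trans_eq (by ring))
    rw [sub_im, sub_im, hh0] at h1
    linarith
  have e1 : Φ w = F z := by simp [hΦ, hw]
  have e2 : Φ 0 = F z₀ := by simp [hΦ]
  rw [← e1, ← e2, himeq, hhim w hwb, Real.circleAverage_def, conjugatePoisson, smul_eq_mul,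
    Complex.ofReal_mul, ← intervalIntegral.integral_ofReal]
  have e3 : (1 / (2 * (Real.pi : ℂ) * I)) = (((2 * Real.pi)⁻¹ : ℝ) : ℂ) * (1 / I) := by
    push_cast
    field_simp
  rw [e3, mul_assoc]
  congr 1
  rw [← intervalIntegral.integral_const_mul]
  apply intervalIntegral.integral_congr
  intro θ _
  have hζ : circleMap 0 r θ = r * exp (I * θ) := by simp [circleMap, mul_comm I]
  have hconj : starRingEnd ℂ (r * exp (I * θ)) = r * exp (-(I * θ)) := by
    rw [map_mul, ← Complex.exp_conj]
    simp
  have hb : z₀ + r * exp (I * θ) ∈ Metric.ball z₀ R := by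
    refine hmem _ ?_
    rw [← hζ]
    exact circleMap_mem_closedBall _ hr.le _
  simp only
  rw [Complex.ofReal_mul, im_herglotzRieszKernel, hζ, hconj, hu _ hb]
  ring

/-- The real and the imaginary part of a holomorphic function are conjugate. -/
theorem isHarmonicConjugateOn_re_im {F : ℂ → ℂ} {u v : ℂ → ℝ} {s : Set ℂ} {c : ℝ} (hs : IsOpen s)
    (hF : AnalyticOnNhd ℂ F s) (hu : ∀ w ∈ s, u w = (F w).re)
    (hv : ∀ w ∈ s, v w = (F w).im - c) : IsHarmonicConjugateOn u v s := by
  have hue : ∀ z ∈ s, u =ᶠ[nhds z] fun w => (F w).re := fun z hz =>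
    Filter.eventually_of_mem (hs.mem_nhds hz) hu
  -- Subtracting the real constant from the imaginary part amounts to subtracting `I * c` from `F`.
  have hve : ∀ z ∈ s, v =ᶠ[nhds z] fun w => (F w - I * c).im := fun z hz =>
    Filter.eventually_of_mem (hs.mem_nhds hz) fun w hw => by simp [hv w hw]
  have hdu : ∀ z ∈ s, HasFDerivAt u
      (Complex.reCLM.comp ((fderiv ℂ F z).restrictScalars ℝ)) z := fun z hz =>
    (Complex.reCLM.hasFDerivAt.comp z
      ((hF z hz).differentiableAt.hasFDerivAt.restrictScalars ℝ)).congr_of_eventuallyEq (hue z hz)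
  have hdv : ∀ z ∈ s, HasFDerivAt v
      (Complex.imCLM.comp ((fderiv ℂ F z).restrictScalars ℝ)) z := fun z hz =>
    (Complex.imCLM.hasFDerivAt.comp z
      (((hF z hz).differentiableAt.hasFDerivAt.sub_const (I * c)).restrictScalars
        ℝ)).congr_of_eventuallyEq (hve z hz)
  -- Complex linearity of the derivative is what yields the Cauchy–Riemann equations.
  have hI : ∀ z, fderiv ℂ F z I = I * fderiv ℂ F z 1 := fun z => by
    rw [← smul_eq_mul, ← map_smul, smul_eq_mul, mul_one]
  refine ⟨fun z hz => ?_, fun z hz => ?_, fun z hz => ?_, fun z hz => ?_⟩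
  · exact (harmonicAt_congr_nhds (hue z hz)).2 (hF z hz).harmonicAt_re
  · exact (harmonicAt_congr_nhds (hve z hz)).2
      (((hF z hz).sub analyticAt_const).harmonicAt_im)
  · rw [(hdu z hz).fderiv, (hdv z hz).fderiv]
    simp [hI]
  · rw [(hdu z hz).fderiv, (hdv z hz).fderiv]
    simp [hI]

/-! ### Basic open sets and names of points of the plane -/

theorem coe_mem_basicSet_exterior {k : ℕ} (hk : k.unpair.1 = 0) (w : ℂ) :
    (w : Sphere) ∈ basicSet k ↔ (posRatOf k.unpair.2 : ℝ) < ‖w‖ := by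
  rw [basicSet, if_pos hk, exteriorDisk, Set.mem_compl_iff,
    OnePoint.coe_injective.mem_set_image, mem_closedBall_zero_iff, not_le]

theorem coe_mem_basicSet_rect {k : ℕ} (hk : k.unpair.1 ≠ 0) (w : ℂ) :
    (w : Sphere) ∈ basicSet k ↔ (reLo k : ℝ) < w.re ∧ w.re < (reHi k : ℝ) ∧
      (imLo k : ℝ) < w.im ∧ w.im < (imHi k : ℝ) := by
  rw [basicSet, if_neg hk, openRect, OnePoint.coe_injective.mem_set_image]
  rfl

theorem posRatOf_pos (k : ℕ) : 0 < posRatOf k := by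
  unfold posRatOf
  positivity

theorem exists_rect_index (a b c d : ℚ) :
    ∃ k, k.unpair.1 ≠ 0 ∧ reLo k = a ∧ reHi k = b ∧ imLo k = c ∧ imHi k = d := by
  obtain ⟨a, rfl⟩ := exists_ratOf_eq a
  obtain ⟨b, rfl⟩ := exists_ratOf_eq b
  obtain ⟨c, rfl⟩ := exists_ratOf_eq c
  obtain ⟨d, rfl⟩ := exists_ratOf_eq d
  exact ⟨Nat.pair 1 (Nat.pair (Nat.pair a b) (Nat.pair c d)), by simp [reLo, reHi, imLo, imHi]⟩

theorem exists_rect_index_near (w : ℂ) {δ : ℝ} (hδ : 0 < δ) :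
    ∃ k, k.unpair.1 ≠ 0 ∧ (w : Sphere) ∈ basicSet k ∧ (halfPerimeter k : ℝ) < δ := by
  obtain ⟨a, ha, ha'⟩ := exists_rat_btwn (show w.re - δ / 4 < w.re by linarith)
  obtain ⟨b, hb, hb'⟩ := exists_rat_btwn (show w.re < w.re + δ / 4 by linarith)
  obtain ⟨c, hc, hc'⟩ := exists_rat_btwn (show w.im - δ / 4 < w.im by linarith)
  obtain ⟨d, hd, hd'⟩ := exists_rat_btwn (show w.im < w.im + δ / 4 by linarith)
  obtain ⟨k, hk, rfl, rfl, rfl, rfl⟩ := exists_rect_index a b c d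
  refine ⟨k, hk, (coe_mem_basicSet_rect hk w).2 ⟨ha', hb, hc', hd⟩, ?_⟩
  rw [halfPerimeter]
  push_cast
  linarith

theorem norm_sub_corner_le {k : ℕ} (hk : k.unpair.1 ≠ 0) {w : ℂ} (hw : (w : Sphere) ∈ basicSet k) :
    ‖w - ⟨reLo k, imLo k⟩‖ ≤ halfPerimeter k := by
  obtain ⟨h1, h2, h3, h4⟩ := (coe_mem_basicSet_rect hk w).1 hw
  refine (Complex.norm_le_abs_re_add_abs_im _).trans ?_
  simp only [sub_re, sub_im, halfPerimeter]
  rw [abs_of_pos (by linarith), abs_of_pos (by linarith)]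
  push_cast
  linarith

/-- Any nonzero first component marks a rectangle, so each rectangle has infinitely many indices.
This supplies the infinite set required by the search machine. -/
theorem infinite_setOf_mem_basicSet (w : ℂ) : {k | (w : Sphere) ∈ basicSet k}.Infinite := by
  obtain ⟨k, hk, hw, -⟩ := exists_rect_index_near w one_pos
  have hinj : Function.Injective fun n : ℕ => Nat.pair (n + 1) k.unpair.2 := fun m n h => by
    simpa using (Nat.pair_eq_pair.1 h).1
  refine (Set.infinite_range_of_injective hinj).mono ?_
  rintro _ ⟨n, rfl⟩
  rw [coe_mem_basicSet_rect hk] at hw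
  refine (coe_mem_basicSet_rect (by simp) w).2 ?_
  simpa [reLo, reHi, imLo, imHi] using hw

/-- A finite list of basic sets that contain a point of the plane extends to a name. -/
theorem exists_isPointName_extending {L : List ℕ} {w : ℂ}
    (hL : ∀ k ∈ L, (w : Sphere) ∈ basicSet k) :
    ∃ p, IsPointName p w ∧ ∀ i x, L[i]? = some x → p i = x := by
  classical
  obtain ⟨k₀, -, hk₀, -⟩ := exists_rect_index_near w one_pos
  -- Beyond the list, position `L.length + k` lists `k` if it is admissible and the harmless default
  -- `k₀` otherwise.
  refine ⟨fun i => (L[i]?).getD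
    (if (w : Sphere) ∈ basicSet (i - L.length) then i - L.length else k₀), fun k => ⟨?_, ?_⟩, ?_⟩
  · rintro ⟨i, rfl⟩
    beta_reduce
    rcases hi : L[i]? with _ | x
    · rw [Option.getD_none]
      split_ifs with h
      · exact h
      · exact hk₀
    · exact hL x (List.mem_of_getElem? hi)
  · intro hk
    refine ⟨L.length + k, ?_⟩
    simp [hk]
  · intro i x hx
    simp [hx]

/-! ### Meaning of the conditions in certificates -/

theorem diskIn_cast {x y r : ℚ} {k : ℕ} (h : DiskIn x y r k) :
    DiskIn (x : ℝ) (y : ℝ) (r : ℝ) k := by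
  unfold DiskIn at h ⊢
  simp only [Rat.cast_id] at h
  exact_mod_cast h

theorem diskIn_of_cast {x y r : ℚ} {k : ℕ} (h : DiskIn (x : ℝ) (y : ℝ) (r : ℝ) k) :
    DiskIn x y r k := by
  unfold DiskIn at h ⊢
  simp only [Rat.cast_id]
  exact_mod_cast h

theorem intervalIn_cast {x y : ℚ} {k : ℕ} (h : IntervalIn x y k) :
    IntervalIn (x : ℝ) (y : ℝ) k := by
  unfold IntervalIn at h ⊢
  simp only [Rat.cast_id] at h
  exact_mod_cast h

theorem intervalIn_of_cast {x y : ℚ} {k : ℕ} (h : IntervalIn (x : ℝ) (y : ℝ) k) :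
    IntervalIn x y k := by
  unfold IntervalIn at h ⊢
  simp only [Rat.cast_id]
  exact_mod_cast h

theorem mem_basicSet_of_diskIn {x y r : ℝ} {k : ℕ} (h : DiskIn x y r k) {w : ℂ}
    (hw : ‖w - ⟨x, y⟩‖ ≤ r) : (w : Sphere) ∈ basicSet k := by
  have hre : |w.re - x| ≤ r := (Complex.abs_re_le_norm (w - ⟨x, y⟩)).trans hw
  have him : |w.im - y| ≤ r := (Complex.abs_im_le_norm (w - ⟨x, y⟩)).trans hw
  rw [abs_le] at hre him
  rcases h with ⟨hk, h⟩ | ⟨hk, h1, h2, h3, h4⟩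
  · rw [coe_mem_basicSet_exterior hk]
    have hpos : (0 : ℝ) < posRatOf k.unpair.2 := by exact_mod_cast posRatOf_pos _
    have hc : (posRatOf k.unpair.2 : ℝ) + r < ‖(⟨x, y⟩ : ℂ)‖ := by
      refine lt_of_pow_lt_pow_left₀ 2 (norm_nonneg _) (h.trans_eq ?_)
      rw [Complex.sq_norm, Complex.normSq_mk]
      ring
    have := norm_le_norm_add_norm_sub w (⟨x, y⟩ : ℂ)
    linarith
  · exact (coe_mem_basicSet_rect hk w).2 ⟨by linarith, by linarith, by linarith, by linarith⟩

/-- All inequalities in the condition are strict and continuous, and they hold at the point itself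
with radius zero. -/
theorem eventually_diskIn {w : ℂ} {k : ℕ} (h : (w : Sphere) ∈ basicSet k) :
    ∀ᶠ q : ℝ × ℝ × ℝ in nhds (w.re, w.im, 0), DiskIn q.1 q.2.1 q.2.2 k := by
  by_cases hk : k.unpair.1 = 0
  · rw [coe_mem_basicSet_exterior hk] at h
    have hpos : (0 : ℝ) < posRatOf k.unpair.2 := by exact_mod_cast posRatOf_pos _
    have h' : ((posRatOf k.unpair.2 : ℝ) + 0) ^ 2 < w.re ^ 2 + w.im ^ 2 := by
      have := pow_lt_pow_left₀ h hpos.le two_ne_zero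
      rw [Complex.sq_norm, Complex.normSq_apply] at this
      rw [add_zero]
      linarith
    have : ∀ᶠ q : ℝ × ℝ × ℝ in nhds (w.re, w.im, 0),
        ((posRatOf k.unpair.2 : ℝ) + q.2.2) ^ 2 < q.1 ^ 2 + q.2.1 ^ 2 :=
      ContinuousAt.eventually_lt (by fun_prop) (by fun_prop) h'
    exact this.mono fun q hq => Or.inl ⟨hk, hq⟩
  · obtain ⟨h1, h2, h3, h4⟩ := (coe_mem_basicSet_rect hk w).1 h
    have e1 : ∀ᶠ q : ℝ × ℝ × ℝ in nhds (w.re, w.im, 0), (reLo k : ℝ) < q.1 - q.2.2 :=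
      ContinuousAt.eventually_lt (by fun_prop) (by fun_prop) (by simpa using h1)
    have e2 : ∀ᶠ q : ℝ × ℝ × ℝ in nhds (w.re, w.im, 0), q.1 + q.2.2 < (reHi k : ℝ) :=
      ContinuousAt.eventually_lt (by fun_prop) (by fun_prop) (by simpa using h2)
    have e3 : ∀ᶠ q : ℝ × ℝ × ℝ in nhds (w.re, w.im, 0), (imLo k : ℝ) < q.2.1 - q.2.2 :=
      ContinuousAt.eventually_lt (by fun_prop) (by fun_prop) (by simpa using h3)
    have e4 : ∀ᶠ q : ℝ × ℝ × ℝ in nhds (w.re, w.im, 0), q.2.1 + q.2.2 < (imHi k : ℝ) :=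
      ContinuousAt.eventually_lt (by fun_prop) (by fun_prop) (by simpa using h4)
    filter_upwards [e1, e2, e3, e4] with q q1 q2 q3 q4
    exact Or.inr ⟨hk, q1, q2, q3, q4⟩

theorem mem_basicSet_of_intervalIn {a b x : ℝ} {k : ℕ} (h : IntervalIn a b k) (ha : a ≤ x)
    (hb : x ≤ b) : (((x : ℝ) : ℂ) : Sphere) ∈ basicSet k := by
  rcases h with ⟨hk, h⟩ | ⟨hk, h1, h2, h3, h4⟩
  · rw [coe_mem_basicSet_exterior hk, Complex.norm_real, Real.norm_eq_abs, lt_abs]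
    rcases h with h | h
    · left; linarith
    · right; linarith
  · refine (coe_mem_basicSet_rect hk _).2 ⟨?_, ?_, ?_, ?_⟩
    · rw [ofReal_re]; linarith
    · rw [ofReal_re]; linarith
    · rw [ofReal_im]; exact h3
    · rw [ofReal_im]; exact h4

theorem eventually_intervalIn {x : ℝ} {k : ℕ} (h : (((x : ℝ) : ℂ) : Sphere) ∈ basicSet k) :
    ∀ᶠ q : ℝ × ℝ in nhds (x, x), IntervalIn q.1 q.2 k := by
  by_cases hk : k.unpair.1 = 0
  · rw [coe_mem_basicSet_exterior hk, Complex.norm_real, Real.norm_eq_abs, lt_abs] at h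
    rcases h with h | h
    · have : ∀ᶠ q : ℝ × ℝ in nhds (x, x), (posRatOf k.unpair.2 : ℝ) < q.1 :=
        ContinuousAt.eventually_lt (by fun_prop) (by fun_prop) h
      exact this.mono fun q hq => Or.inl ⟨hk, Or.inl hq⟩
    · have : ∀ᶠ q : ℝ × ℝ in nhds (x, x), q.2 < -(posRatOf k.unpair.2 : ℝ) :=
        ContinuousAt.eventually_lt (by fun_prop) (by fun_prop) (by simp only; linarith)
      exact this.mono fun q hq => Or.inl ⟨hk, Or.inr hq⟩
  · obtain ⟨h1, h2, h3, h4⟩ := (coe_mem_basicSet_rect hk _).1 h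
    rw [ofReal_re] at h1 h2
    rw [ofReal_im] at h3 h4
    have e1 : ∀ᶠ q : ℝ × ℝ in nhds (x, x), (reLo k : ℝ) < q.1 :=
      ContinuousAt.eventually_lt (by fun_prop) (by fun_prop) h1
    have e2 : ∀ᶠ q : ℝ × ℝ in nhds (x, x), q.2 < (reHi k : ℝ) :=
      ContinuousAt.eventually_lt (by fun_prop) (by fun_prop) h2
    filter_upwards [e1, e2] with q q1 q2
    exact Or.inr ⟨hk, q1, q2, h3, h4⟩

/-! ### Information on the tape -/

theorem triple_zero (a b c : ℕ → ℕ) : triple a b c 0 = a 0 := rfl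

theorem triple_first (a b c : ℕ → ℕ) (n : ℕ) : triple a b c (3 * n + 3) = a (n + 1) := by
  rw [triple, if_pos (by omega), show (3 * n + 3) / 3 = n + 1 by omega]

theorem triple_second (a b c : ℕ → ℕ) (n : ℕ) : triple a b c (3 * n + 1) = b n := by
  rw [triple, if_neg (by omega), if_pos (by omega), show (3 * n + 1) / 3 = n by omega]

theorem triple_third (a b c : ℕ → ℕ) (n : ℕ) : triple a b c (3 * n + 2) = c n := by
  rw [triple, if_neg (by omega), if_neg (by omega), show (3 * n + 2) / 3 = n by omega]

theorem pair_mem_graphSet {T : ℕ → ℕ} {n m : ℕ} : Nat.pair n m ∈ graphSet T ↔ T n = m := by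
  simp [graphSet]

section Tape

variable {H : List ℕ} {X : Set ℕ} {e : Nat.Partrec.Code} {p₀ pR p : ℕ → ℕ}

theorem bit_eq_of_knownOracle
    (hH : Correct H (graphSet (triple (functionTape X e) p₀ pR)) p) {x r : ℕ}
    (h : knownOracle H x = some r) : bit X x = r := by
  have key : ∀ m, KnowsOracle H (Nat.pair (3 * x + 3) m) → bit X x = m := fun m hm => by
    have := pair_mem_graphSet.1 (hH.oracle _ hm)
    rwa [triple_first] at this
  unfold knownOracle at h
  split_ifs at h with h1 h0
  · rw [key 1 h1]; simpa using h
  · rw [key 0 h0]; simpa using h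

theorem knownOracle_eq
    (hH : Correct H (graphSet (triple (functionTape X e) p₀ pR)) p) {b x : ℕ}
    (hb : CompleteTo H (graphSet (triple (functionTape X e) p₀ pR)) p b)
    (hx : Nat.pair (3 * x + 3) 1 ≤ b) : knownOracle H x = some (bit X x) := by
  have hx0 : Nat.pair (3 * x + 3) 0 ≤ b :=
    (Nat.pair_lt_pair_right (3 * x + 3) (by norm_num : 0 < 1)).le.trans hx
  have hmem : Nat.pair (3 * x + 3) (bit X x) ∈ graphSet (triple (functionTape X e) p₀ pR) := by
    rw [pair_mem_graphSet, triple_first]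
    rfl
  have hbit : bit X x = 1 ∨ bit X x = 0 := by
    unfold bit
    split_ifs <;> simp
  have hsome : ∃ r, knownOracle H x = some r := by
    rcases hbit with h | h
    · rw [h] at hmem
      exact ⟨1, if_pos (hb.oracle _ hx hmem)⟩
    · rw [h] at hmem
      have := hb.oracle _ hx0 hmem
      unfold KnowsOracle at this
      unfold knownOracle
      split_ifs
      · exact ⟨1, rfl⟩
      · exact ⟨0, rfl⟩
  obtain ⟨r, hr⟩ := hsome
  rw [hr, bit_eq_of_knownOracle hH hr]

end Tape

/-! ### Soundness of certificates -/

section Soundness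

variable {H : List ℕ} {X : Set ℕ} {e : Nat.Partrec.Code} {p₀ pR p : ℕ → ℕ} {u : Sphere → ℝ}
  {D : Set Sphere}

/-- Any `w` in the disk has a name beginning with the certified list, so the simulated computation
is part of a true run on that name. The rectangle it writes therefore contains `u w`, and ball
arithmetic encloses `Re P(w)`. -/
theorem CellCert.abs_sub_le {P : List (ℕ × ℕ)} {ε x y r : ℚ} {n : ℕ}
    (hH : Correct H (graphSet (triple (functionTape X e) p₀ pR)) p)
    (hu : IsFunctionName X e D (realFun u)) (hn : CellCert H e P ε x y r n) {w : ℂ}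
    (hw : ‖w - ⟨x, y⟩‖ ≤ r) (hwD : (w : Sphere) ∈ D) :
    |u w - (polyEval P w).re| ≤ ε := by
  obtain ⟨h1, h2, h3, h4, h5⟩ := hn
  set q := Denumerable.ofNat (List ℕ × ℕ × ℕ × ℕ) n
  obtain ⟨a, ha, haL⟩ := exists_isPointName_extending (L := q.1) (w := w) fun k hk =>
    mem_basicSet_of_diskIn (diskIn_cast (h1 k hk)) hw
  obtain ⟨b, hb, hbu⟩ := hu w hwD a ha
  have hmem : realFun u w ∈ basicSet q.2.1 :=
    (hbu _).1 ((hb.exists_eq_iff _).2 ⟨_, writesAt_of_simOut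
      (fun x r => bit_eq_of_knownOracle hH) haL h2⟩)
  obtain ⟨m1, m2, -, -⟩ := (coe_mem_basicSet_rect h3 _).1 hmem
  rw [ofReal_re] at m1 m2
  have hP := norm_polyEval_sub_le P hw
  rw [← hornerBall_center P x y r, hornerBall_cast] at hP
  have hre := abs_le.1 ((Complex.abs_re_le_norm _).trans hP)
  simp only [sub_re] at hre
  have h4' : ((hornerBall P x y r).1 : ℝ) + (hornerBall P x y r).2.2 - reLo q.2.1 ≤ ε := by
    exact_mod_cast h4
  have h5' : (reHi q.2.1 : ℝ) - ((hornerBall P x y r).1 - (hornerBall P x y r).2.2) ≤ ε := by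
    exact_mod_cast h5
  rw [abs_le]
  constructor <;> linarith

/-- Rounding both coordinates down to the grid moves `w` by at most `2h`. The grid point found is
then at distance at most `S + 2h` from the center, so it must carry a cell certificate. -/
theorem CoverCert.abs_sub_le {P : List (ℕ × ℕ)} {ε x₀ y₀ S h : ℚ} {b N : ℕ}
    (hH : Correct H (graphSet (triple (functionTape X e) p₀ pR)) p)
    (hu : IsFunctionName X e D (realFun u)) (hh : 0 < h)
    (hc : CoverCert H b e P ε x₀ y₀ S h N) {w : ℂ}
    (hw : ‖w - ⟨x₀, y₀⟩‖ ≤ S) (hwD : (w : Sphere) ∈ D) :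
    |u w - (polyEval P w).re| ≤ ε := by
  obtain ⟨hS, hc⟩ := hc
  have hh' : (0 : ℝ) < h := by exact_mod_cast hh
  have hS' : (S : ℝ) ≤ N * h := by exact_mod_cast hS
  have index : ∀ t : ℝ, |t| ≤ S → ∃ i < 2 * N + 1, |t - h * ((i : ℝ) - N)| ≤ h := by
    intro t ht
    rw [abs_le] at ht
    have h0 : 0 ≤ t / h + N := by
      have : -(N : ℝ) ≤ t / h := by rw [le_div_iff₀ hh']; linarith
      linarith
    have h1 : t / h + N ≤ 2 * N := by
      have : t / h ≤ N := by rw [div_le_iff₀ hh']; linarith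
      linarith
    refine ⟨⌊t / h + N⌋₊, ?_, ?_⟩
    · have : (⌊t / h + N⌋₊ : ℝ) ≤ (2 * N : ℕ) := by
        push_cast
        exact (Nat.floor_le h0).trans h1
      have := Nat.cast_le.1 this
      omega
    · have f1 := Nat.floor_le h0
      have f2 := Nat.lt_floor_add_one (t / h + N)
      have e1 : t - h * ((⌊t / h + N⌋₊ : ℝ) - N) = h * (t / h + N - ⌊t / h + N⌋₊) := by
        field_simp
        ring
      rw [e1, abs_of_nonneg (mul_nonneg hh'.le (by linarith))]
      nlinarith
  obtain ⟨i, hi, hi'⟩ := index (w.re - x₀)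
    ((Complex.abs_re_le_norm (w - ⟨x₀, y₀⟩)).trans hw)
  obtain ⟨j, hj, hj'⟩ := index (w.im - y₀)
    ((Complex.abs_im_le_norm (w - ⟨x₀, y₀⟩)).trans hw)
  set c : ℂ := ⟨h * ((i : ℝ) - N), h * ((j : ℝ) - N)⟩ with hcdef
  have hdist : ‖w - ⟨x₀, y₀⟩ - c‖ ≤ 2 * h := by
    refine (Complex.norm_le_abs_re_add_abs_im _).trans ?_
    simp only [hcdef, sub_re, sub_im]
    linarith
  rcases hc i hi j hj with hfar | ⟨n, -, hn⟩
  · exfalso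
    have hfar' : ((S : ℝ) + 2 * h) ^ 2 < (h * ((i : ℝ) - N)) ^ 2 + (h * ((j : ℝ) - N)) ^ 2 := by
      exact_mod_cast hfar
    have hc : ‖c‖ ≤ S + 2 * h := by
      have := norm_le_norm_add_norm_sub (w - ⟨x₀, y₀⟩) c
      linarith
    have := pow_le_pow_left₀ (norm_nonneg _) hc 2
    rw [Complex.sq_norm, Complex.normSq_apply] at this
    simp only [hcdef] at this
    linarith
  · refine hn.abs_sub_le hH hu ?_ hwD
    push_cast
    convert hdist using 2
    apply Complex.ext <;> simp [hcdef] <;> ring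

/-- `F - P` has real part at most `ε` in modulus on the disk of radius `ρ`, so Borel–Carathéodory
puts the value within `τ` of `Im P(z) - Im P(z₀)`. The two enclosures of `P` account for the inexact
knowledge of `z` and `z₀`. -/
theorem ValueCert.mem_basicSet {b k c i₀ k₀ iR kR i₁ k₁ N : ℕ} {P : List (ℕ × ℕ)}
    {ρ σ ε τ h : ℚ} {F : ℂ → ℂ} {z₀ z : ℂ} {R : ℝ}
    (hH : Correct H (graphSet (triple (functionTape X e) p₀ pR)) p)
    (hu : IsFunctionName X e D (realFun u)) (hD : ∀ w ∈ Metric.ball z₀ R, (w : Sphere) ∈ D)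
    (hF : DifferentiableOn ℂ F (Metric.ball z₀ R))
    (hFu : ∀ w ∈ Metric.ball z₀ R, u w = (F w).re)
    (hp₀ : IsPointName p₀ z₀) (hpR : IsPointName pR (R : ℂ)) (hp : IsPointName p z)
    (hcert : ValueCert H b k c i₀ k₀ iR kR i₁ k₁ P ρ σ ε τ h N) :
    ((((F z).im - (F z₀).im : ℝ) : ℂ) : Sphere) ∈ basicSet k := by
  obtain ⟨⟨o1, o2, o3, o4⟩, ⟨n0, nR, n1⟩, ⟨hε, hσ, hh, hρR, hσ', hρ, hτ⟩, hcov, hint⟩ := hcert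
  have hc : Denumerable.ofNat Nat.Partrec.Code c = e := by
    have := pair_mem_graphSet.1 (hH.oracle _ o1)
    rw [triple_zero] at this
    rw [← this]
    exact Denumerable.ofNat_encode e
  rw [hc] at hcov
  have m0 : (z₀ : Sphere) ∈ basicSet k₀ := (hp₀ k₀).1 ⟨i₀, by
    rw [← triple_second (functionTape X e) p₀ pR]; exact pair_mem_graphSet.1 (hH.oracle _ o2)⟩
  have mR : ((R : ℂ) : Sphere) ∈ basicSet kR := (hpR kR).1 ⟨iR, by
    rw [← triple_third (functionTape X e) p₀ pR]; exact pair_mem_graphSet.1 (hH.oracle _ o3)⟩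
  have m1 : (z : Sphere) ∈ basicSet k₁ := (hp k₁).1 ⟨i₁, hH.input _ _ o4⟩
  have d0 := norm_sub_corner_le n0 m0
  have d1 := norm_sub_corner_le n1 m1
  have hRlo : (reLo kR : ℝ) < R := by
    have := ((coe_mem_basicSet_rect nR _).1 mR).1
    rwa [ofReal_re] at this
  set x₀ : ℂ := ⟨reLo k₀, imLo k₀⟩
  set x₁ : ℂ := ⟨reLo k₁, imLo k₁⟩
  set η₀ := halfPerimeter k₀
  set η₁ := halfPerimeter k₁
  have hε' : (0 : ℝ) < ε := by exact_mod_cast hε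
  have hσ0 : (0 : ℝ) ≤ σ := by exact_mod_cast hσ
  have hρR' : (ρ : ℝ) + 2 * η₀ ≤ reLo kR := by exact_mod_cast hρR
  have hσ'' : ((reLo k₁ : ℝ) - reLo k₀) ^ 2 + ((imLo k₁ : ℝ) - imLo k₀) ^ 2 ≤ (σ : ℝ) ^ 2 := by
    exact_mod_cast hσ'
  have hρ' : (σ : ℝ) + η₀ + η₁ < ρ := by exact_mod_cast hρ
  have hτ' : 4 * (ε : ℝ) * ρ ≤ τ * (ρ - σ - η₀ - η₁) := by exact_mod_cast hτ
  have hη₀ : (0 : ℝ) ≤ η₀ := (norm_nonneg _).trans d0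
  have hη₁ : (0 : ℝ) ≤ η₁ := (norm_nonneg _).trans d1
  have hx : ‖x₁ - x₀‖ ≤ σ := by
    refine le_of_sq_le_sq ?_ hσ0
    rw [Complex.sq_norm, Complex.normSq_apply]
    simp only [x₀, x₁, sub_re, sub_im]
    linarith
  have hz : ‖z - z₀‖ ≤ σ + η₀ + η₁ := by
    calc ‖z - z₀‖ = ‖(z - x₁) + (x₁ - x₀) - (z₀ - x₀)‖ := by congr 1; ring
      _ ≤ ‖z - x₁‖ + ‖x₁ - x₀‖ + ‖z₀ - x₀‖ :=
        (norm_sub_le _ _).trans (add_le_add (norm_add_le _ _) le_rfl)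
      _ ≤ _ := by linarith
  have hsub : Metric.ball z₀ ρ ⊆ Metric.ball z₀ R := Metric.ball_subset_ball (by linarith)
  have happrox : ∀ w ∈ Metric.ball z₀ ρ, |(F w - polyEval P w).re| ≤ ε := by
    intro w hw
    rw [sub_re, ← hFu w (hsub hw)]
    refine hcov.abs_sub_le hH hu hh ?_ (hD w (hsub hw))
    rw [Metric.mem_ball, dist_eq_norm] at hw
    push_cast
    calc ‖w - x₀‖ = ‖(w - z₀) + (z₀ - x₀)‖ := by congr 1; ring
      _ ≤ ρ + η₀ := (norm_add_le _ _).trans (by linarith)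
  have hzρ : z ∈ Metric.ball z₀ ρ := by
    rw [Metric.mem_ball, dist_eq_norm]
    linarith
  have hBC := abs_im_sub_im_le (f := fun w => F w - polyEval P w) hε'
    ((hF.mono hsub).sub (differentiable_polyEval P).differentiableOn) happrox hzρ
  have hBC' : 4 * (ε : ℝ) * ‖z - z₀‖ / (ρ - ‖z - z₀‖) ≤ τ := by
    have hpos : (0 : ℝ) < ρ - σ - η₀ - η₁ := by linarith
    -- The sign of `τ` is not part of the certificate; it follows from the inequality that bounds
    -- `4ερ`.
    have hτ0 : (0 : ℝ) ≤ τ := by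
      by_contra hneg
      have : (τ : ℝ) * (ρ - σ - η₀ - η₁) < 0 := mul_neg_of_neg_of_pos (not_le.1 hneg) hpos
      have : 0 ≤ 4 * (ε : ℝ) * ρ := by
        have : (0 : ℝ) ≤ ρ := by linarith
        positivity
      linarith
    rw [div_le_iff₀ (by linarith)]
    calc 4 * (ε : ℝ) * ‖z - z₀‖ ≤ 4 * ε * ρ := by gcongr; linarith
      _ ≤ τ * (ρ - σ - η₀ - η₁) := hτ'
      _ ≤ τ * (ρ - ‖z - z₀‖) := mul_le_mul_of_nonneg_left (by linarith) hτ0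
  have e0 := norm_polyEval_sub_le P d0
  have e1 := norm_polyEval_sub_le P d1
  rw [← hornerBall_center P (reLo k₀) (imLo k₀) (η₀ : ℝ), hornerBall_cast] at e0
  rw [← hornerBall_center P (reLo k₁) (imLo k₁) (η₁ : ℝ), hornerBall_cast] at e1
  have i0 := abs_le.1 ((Complex.abs_im_le_norm _).trans e0)
  have i1 := abs_le.1 ((Complex.abs_im_le_norm _).trans e1)
  have iBC := abs_le.1 (hBC.trans hBC')
  simp only [sub_im] at i0 i1 iBC
  refine mem_basicSet_of_intervalIn (intervalIn_cast hint) ?_ ?_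
  · push_cast
    linarith
  · push_cast
    linarith

end Soundness

/-! ### Completeness of certificates -/

theorem CompleteTo.mono {H : List ℕ} {Y : Set ℕ} {p : ℕ → ℕ} {b b' : ℕ} (h : CompleteTo H Y p b')
    (hb : b ≤ b') : CompleteTo H Y p b :=
  ⟨fun y hy => h.oracle y (hy.trans hb), fun n hn => h.input n (hn.trans hb)⟩

section Completeness

variable {X : Set ℕ} {e : Nat.Partrec.Code} {p₀ pR p : ℕ → ℕ} {u : Sphere → ℝ} {D : Set Sphere}

/-- On some name of `w` the machine must eventually write a rectangle lying tightly around `u w`. By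
then it has used finitely many open sets containing `w`, so the same run certifies all small disks
near `w`. -/
theorem exists_cellCert_near {P : List (ℕ × ℕ)} {ε : ℚ} {w : ℂ}
    (hu : IsFunctionName X e D (realFun u)) (hw : (w : Sphere) ∈ D)
    (hP : |u w - (polyEval P w).re| < ε) :
    ∃ n b : ℕ, ∃ δ > (0 : ℝ), ∀ x y r : ℚ, ‖(⟨x, y⟩ : ℂ) - w‖ < δ → |(r : ℝ)| < δ →
      ∀ H p, Correct H (graphSet (triple (functionTape X e) p₀ pR)) p →
        CompleteTo H (graphSet (triple (functionTape X e) p₀ pR)) p b →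
        CellCert H e P ε x y r n := by
  rw [abs_lt] at hP
  obtain ⟨α, hα, hα'⟩ := exists_rat_btwn (show (polyEval P w).re - ε < u w by linarith)
  obtain ⟨β, hβ, hβ'⟩ := exists_rat_btwn (show u w < (polyEval P w).re + ε by linarith)
  -- Values of `u` are real, so any imaginary range around `0` serves.
  obtain ⟨k, hk, rfl, rfl, hlo, hhi⟩ := exists_rect_index α β (-1) 1
  have hmem : realFun u w ∈ basicSet k := by
    refine (coe_mem_basicSet_rect hk _).2 ⟨?_, ?_, ?_, ?_⟩ <;> simp [hlo, hhi, hα', hβ]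
  obtain ⟨a, ha, -⟩ := exists_isPointName_extending (L := []) (w := w) (by simp)
  obtain ⟨q, hq, hqu⟩ := hu w hw a ha
  obtain ⟨t, ht⟩ := (hq.exists_eq_iff k).1 ((hqu k).2 hmem)
  obtain ⟨m, hm⟩ := exists_forall_simOut_eq ht
  set L := (List.range m).map a with hL
  have hLw : ∀ j ∈ L, (w : Sphere) ∈ basicSet j := by
    intro j hj
    obtain ⟨i, -, rfl⟩ := List.mem_map.1 hj
    exact (ha _).1 ⟨i, rfl⟩
  have hcont := continuous_hornerBall P
  have hcenter : (hornerBall P w.re w.im 0).1 = (polyEval P w).re := by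
    have := congrArg Complex.re (hornerBall_center P w.re w.im 0)
    simpa using this
  have ev1 : ∀ᶠ q : ℝ × ℝ × ℝ in nhds (w.re, w.im, 0), ∀ j ∈ L, DiskIn q.1 q.2.1 q.2.2 j :=
    (Filter.eventually_all_finite (List.finite_toSet L)).2 fun j hj => eventually_diskIn (hLw j hj)
  have ev2 : ∀ᶠ q : ℝ × ℝ × ℝ in nhds (w.re, w.im, 0),
      (hornerBall P q.1 q.2.1 q.2.2).1 + (hornerBall P q.1 q.2.1 q.2.2).2.2 - reLo k < ε := by
    refine ContinuousAt.eventually_lt (by fun_prop) (by fun_prop) ?_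
    simp only [hcenter, hornerBall_radius_zero]
    linarith
  have ev3 : ∀ᶠ q : ℝ × ℝ × ℝ in nhds (w.re, w.im, 0),
      reHi k - ((hornerBall P q.1 q.2.1 q.2.2).1 - (hornerBall P q.1 q.2.1 q.2.2).2.2) < ε := by
    refine ContinuousAt.eventually_lt (by fun_prop) (by fun_prop) ?_
    simp only [hcenter, hornerBall_radius_zero]
    linarith
  obtain ⟨δ, hδ, hball⟩ := Metric.eventually_nhds_iff.1 (ev1.and (ev2.and ev3))
  -- The run uses oracle bits below `m`; the largest pair tested for them is `⟨3m + 3, 1⟩`, up to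
  -- which the replies must be complete.
  refine ⟨Encodable.encode (L, k, m, t), Nat.pair (3 * m + 3) 1, δ, hδ,
    fun x y r hxy hr H p hH hb => ?_⟩
  obtain ⟨c1, c2, c3⟩ := hball (y := ((x : ℝ), (y : ℝ), (r : ℝ))) (by
    rw [Prod.dist_eq, Prod.dist_eq]
    refine max_lt ?_ (max_lt ?_ ?_)
    · exact (Complex.abs_re_le_norm ((⟨x, y⟩ : ℂ) - w)).trans_lt hxy
    · exact (Complex.abs_im_le_norm ((⟨x, y⟩ : ℂ) - w)).trans_lt hxy
    · rwa [Real.dist_eq, sub_zero])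
  simp only [hornerBall_cast] at c2 c3
  unfold CellCert
  simp only [Denumerable.ofNat_encode]
  refine ⟨fun j hj => diskIn_of_cast (c1 j hj), ?_, hk, ?_, ?_⟩
  · refine hm _ L m le_rfl (fun x hx => knownOracle_eq hH hb ?_) fun i hi => ?_
    · exact (Nat.pair_lt_pair_left 1 (by omega)).le
    · simp [hL, hi]
  · exact_mod_cast c2.le
  · exact_mod_cast c3.le

/-- Compactness makes the local `δ` and `b` uniform: the property passes to subsets, and to unions
with the smaller `δ` and the larger `b`. -/
theorem exists_forall_cellCert {P : List (ℕ × ℕ)} {ε : ℚ} {K : Set ℂ} (hK : IsCompact K)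
    (hu : IsFunctionName X e D (realFun u)) (hKD : ∀ w ∈ K, (w : Sphere) ∈ D)
    (hP : ∀ w ∈ K, |u w - (polyEval P w).re| < ε) :
    ∃ δ > (0 : ℝ), ∃ b : ℕ, ∀ x y r : ℚ, (⟨x, y⟩ : ℂ) ∈ K → |(r : ℝ)| < δ →
      ∀ H p, Correct H (graphSet (triple (functionTape X e) p₀ pR)) p →
        CompleteTo H (graphSet (triple (functionTape X e) p₀ pR)) p b →
        ∃ n < b, CellCert H e P ε x y r n := by
  refine hK.induction_on (p := fun s => ∃ δ > (0 : ℝ), ∃ b : ℕ, ∀ x y r : ℚ, (⟨x, y⟩ : ℂ) ∈ s →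
    |(r : ℝ)| < δ → ∀ H p, Correct H (graphSet (triple (functionTape X e) p₀ pR)) p →
        CompleteTo H (graphSet (triple (functionTape X e) p₀ pR)) p b →
        ∃ n < b, CellCert H e P ε x y r n) ?_ ?_ ?_ ?_
  · exact ⟨1, one_pos, 0, fun x y r hx => absurd hx (Set.notMem_empty _)⟩
  · rintro s t hst ⟨δ, hδ, b, h⟩
    exact ⟨δ, hδ, b, fun x y r hx => h x y r (hst hx)⟩
  · rintro s t ⟨δ, hδ, b, h⟩ ⟨δ', hδ', b', h'⟩
    refine ⟨min δ δ', lt_min hδ hδ', max b b', fun x y r hx hr H p hH hb => ?_⟩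
    rcases hx with hx | hx
    · obtain ⟨n, hn, hc⟩ := h x y r hx (hr.trans_le (min_le_left _ _)) H p hH
        (hb.mono (le_max_left _ _))
      exact ⟨n, hn.trans_le (le_max_left _ _), hc⟩
    · obtain ⟨n, hn, hc⟩ := h' x y r hx (hr.trans_le (min_le_right _ _)) H p hH
        (hb.mono (le_max_right _ _))
      exact ⟨n, hn.trans_le (le_max_right _ _), hc⟩
  · intro w hw
    obtain ⟨n, b, δ, hδ, h⟩ := exists_cellCert_near (p₀ := p₀) (pR := pR) hu (hKD w hw) (hP w hw)
    refine ⟨Metric.ball w δ, mem_nhdsWithin_of_mem_nhds (Metric.ball_mem_nhds w hδ), δ, hδ,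
      max b (n + 1), fun x y r hx hr H p hH hb => ⟨n, by omega, ?_⟩⟩
    rw [Metric.mem_ball, dist_eq_norm] at hx
    exact h x y r hx hr H p hH (hb.mono (le_max_left _ _))

/-- Rational bounds for the certificate of a value, which hold if the data are close to the center,
the argument and the radius. -/
theorem eventually_certificate_bounds (P : List (ℕ × ℕ)) {ρ σ ε τ R y : ℝ} {z₀ z : ℂ} {k : ℕ}
    {γ : ℝ} (hγ : ∀ a b : ℝ, |a - y| < γ → |b - y| < γ → IntervalIn a b k) (hρR : ρ < R)
    (hσ : ‖z - z₀‖ < σ) (hσρ : σ < ρ) (hετ : 4 * ε * ρ < τ * (ρ - σ)) (hτ : 0 < τ)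
    (hτγ : τ + |(polyEval P z).im - (polyEval P z₀).im - y| < γ) :
    ∀ᶠ q : (ℝ × ℝ × ℝ) × (ℝ × ℝ × ℝ) × ℝ in nhds ((z₀.re, z₀.im, 0), (z.re, z.im, 0), R),
      (ρ + 2 * q.1.2.2 < q.2.2 ∧
        (q.2.1.1 - q.1.1) ^ 2 + (q.2.1.2.1 - q.1.2.1) ^ 2 < σ ^ 2 ∧
        σ + q.1.2.2 + q.2.1.2.2 < ρ ∧
        4 * ε * ρ < τ * (ρ - σ - q.1.2.2 - q.2.1.2.2)) ∧
      IntervalIn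
        ((hornerBall P q.2.1.1 q.2.1.2.1 q.2.1.2.2).2.1
          - (hornerBall P q.1.1 q.1.2.1 q.1.2.2).2.1
          - ((hornerBall P q.2.1.1 q.2.1.2.1 q.2.1.2.2).2.2
            + (hornerBall P q.1.1 q.1.2.1 q.1.2.2).2.2 + τ))
        ((hornerBall P q.2.1.1 q.2.1.2.1 q.2.1.2.2).2.1
          - (hornerBall P q.1.1 q.1.2.1 q.1.2.2).2.1
          + ((hornerBall P q.2.1.1 q.2.1.2.1 q.2.1.2.2).2.2
            + (hornerBall P q.1.1 q.1.2.1 q.1.2.2).2.2 + τ)) k := by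
  have hcenter : ∀ w : ℂ, (hornerBall P w.re w.im 0).2.1 = (polyEval P w).im := fun w => by
    have := congrArg Complex.im (hornerBall_center P w.re w.im 0)
    simpa using this
  have hc : Continuous fun q : (ℝ × ℝ × ℝ) × (ℝ × ℝ × ℝ) × ℝ =>
      hornerBall P q.1.1 q.1.2.1 q.1.2.2 := (continuous_hornerBall P).comp continuous_fst
  have hc' : Continuous fun q : (ℝ × ℝ × ℝ) × (ℝ × ℝ × ℝ) × ℝ =>
      hornerBall P q.2.1.1 q.2.1.2.1 q.2.1.2.2 :=
    (continuous_hornerBall P).comp (continuous_fst.comp continuous_snd)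
  have hsq : (z.re - z₀.re) ^ 2 + (z.im - z₀.im) ^ 2 < σ ^ 2 := by
    have := pow_lt_pow_left₀ hσ (norm_nonneg _) two_ne_zero
    rw [Complex.sq_norm, Complex.normSq_apply] at this
    simp only [sub_re, sub_im] at this
    linarith
  refine Filter.Eventually.and ?_ ?_
  · refine (ContinuousAt.eventually_lt (by fun_prop) (by fun_prop) ?_).and
      ((ContinuousAt.eventually_lt (by fun_prop) (by fun_prop) ?_).and
      ((ContinuousAt.eventually_lt (by fun_prop) (by fun_prop) ?_).and
      (ContinuousAt.eventually_lt (by fun_prop) (by fun_prop) ?_)))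
    · simpa using hρR
    · exact hsq
    · simpa using hσρ
    · simpa using hετ
  · refine ((ContinuousAt.eventually_lt (g := fun _ => γ) (f := fun q => |_ - y|)
      (by fun_prop) (by fun_prop) ?_).and
      (ContinuousAt.eventually_lt (g := fun _ => γ) (f := fun q => |_ - y|)
        (by fun_prop) (by fun_prop) ?_)).mono fun q hq => hγ _ _ hq.1 hq.2
    · simp only [hcenter, hornerBall_radius_zero]
      refine lt_of_le_of_lt ?_ hτγ
      rw [abs_le]
      have := abs_le.1 (le_refl |(polyEval P z).im - (polyEval P z₀).im - y|)
      constructor <;> linarith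
    · simp only [hcenter, hornerBall_radius_zero]
      refine lt_of_le_of_lt ?_ hτγ
      rw [abs_le]
      have := abs_le.1 (le_refl |(polyEval P z).im - (polyEval P z₀).im - y|)
      constructor <;> linarith

/-- The data are chosen in an order that keeps all strict inequalities true: first the radii and
tolerances, then `P`, then rectangles small relative to these, and the mesh `h` last. -/
theorem exists_certified {F : ℂ → ℂ} {z₀ z : ℂ} {R R' : ℝ} {k : ℕ}
    (hu : IsFunctionName X e D (realFun u)) (hR : 0 < R) (hRR' : R < R')
    (hD : ∀ w ∈ Metric.closedBall z₀ R, (w : Sphere) ∈ D)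
    (hF : DifferentiableOn ℂ F (Metric.ball z₀ R'))
    (hFu : ∀ w ∈ Metric.ball z₀ R', u w = (F w).re)
    (hp₀ : IsPointName p₀ z₀) (hpR : IsPointName pR (R : ℂ)) (hp : IsPointName p z)
    (hz : z ∈ Metric.ball z₀ R)
    (hk : ((((F z).im - (F z₀).im : ℝ) : ℂ) : Sphere) ∈ basicSet k) :
    ∃ s, s.unpair.1 = k ∧ ∀ H, Correct H (graphSet (triple (functionTape X e) p₀ pR)) p →
      CompleteTo H (graphSet (triple (functionTape X e) p₀ pR)) p s → Certified (H, s) := by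
  set T := triple (functionTape X e) p₀ pR with hT
  set y := (F z).im - (F z₀).im with hy
  obtain ⟨γ, hγ, hγ'⟩ := Metric.eventually_nhds_iff.1 (eventually_intervalIn hk)
  have hint : ∀ a b : ℝ, |a - y| < γ → |b - y| < γ → IntervalIn a b k := fun a b ha hb =>
    hγ' (y := (a, b)) (by rw [Prod.dist_eq]; exact max_lt ha hb)
  rw [Metric.mem_ball, dist_eq_norm] at hz
  obtain ⟨σ, hσ, hσR⟩ := exists_rat_btwn hz
  obtain ⟨ρ, hσρ, hρR⟩ := exists_rat_btwn hσR
  obtain ⟨τ, hτ, hτγ⟩ := exists_rat_btwn (half_pos hγ)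
  have hσ0 : (0 : ℝ) ≤ σ := (norm_nonneg _).trans hσ.le
  have hρ0 : (0 : ℝ) < ρ := hσ0.trans_lt hσρ
  -- This choice gives `4ερ < τ(ρ - σ)`, leaving room for small half perimeters.
  obtain ⟨ε, hε, hετ⟩ := exists_rat_btwn (show 0 < τ * ((ρ : ℝ) - σ) / (4 * ρ) from
    div_pos (mul_pos hτ (by linarith)) (by linarith))
  rw [lt_div_iff₀ (by linarith)] at hετ
  -- The bound `ε` serves the real part; `γ / 4` at each of `z` and `z₀` leaves, with `τ < γ / 2`, a
  -- total error below `γ`.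
  obtain ⟨P, hP⟩ := exists_polyEval_near hR hRR' hF (lt_min hε (show 0 < γ / 4 by linarith))
  have hPu : ∀ w ∈ Metric.closedBall z₀ R, |u w - (polyEval P w).re| < ε := fun w hw => by
    rw [hFu w (Metric.closedBall_subset_ball hRR' hw), ← sub_re]
    exact (Complex.abs_re_le_norm _).trans_lt ((hP w hw).trans_le (min_le_left _ _))
  have hPim : ∀ w ∈ Metric.closedBall z₀ R, |(F w).im - (polyEval P w).im| < γ / 4 :=
    fun w hw => by
      rw [← sub_im]
      exact (Complex.abs_im_le_norm _).trans_lt ((hP w hw).trans_le (min_le_right _ _))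
  have hPy : (τ : ℝ) + |(polyEval P z).im - (polyEval P z₀).im - y| < γ := by
    have h1 := abs_lt.1 (hPim z (by rw [Metric.mem_closedBall, dist_eq_norm]; exact hz.le))
    have h2 := abs_lt.1 (hPim z₀ (Metric.mem_closedBall_self hR.le))
    have : |(polyEval P z).im - (polyEval P z₀).im - y| < γ / 2 := by
      rw [abs_lt]
      constructor <;> linarith
    linarith
  obtain ⟨δ, hδ, hball⟩ := Metric.eventually_nhds_iff.1 (eventually_certificate_bounds P hint hρR hσ
    hσρ (by linarith : 4 * (ε : ℝ) * ρ < τ * (ρ - σ)) hτ hPy)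
  obtain ⟨k₀, n0, m0, d0⟩ := exists_rect_index_near z₀ hδ
  obtain ⟨k₁, n1, m1, d1⟩ := exists_rect_index_near z hδ
  obtain ⟨kR, nR, mR, dR⟩ := exists_rect_index_near (R : ℂ) hδ
  have c0 := norm_sub_corner_le n0 m0
  have c1 := norm_sub_corner_le n1 m1
  have cR := norm_sub_corner_le nR mR
  have near : ∀ (w : ℂ) (k : ℕ), ‖w - ⟨reLo k, imLo k⟩‖ ≤ halfPerimeter k →
      (halfPerimeter k : ℝ) < δ → |(reLo k : ℝ) - w.re| < δ ∧ |(imLo k : ℝ) - w.im| < δ ∧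
      |(halfPerimeter k : ℝ) - 0| < δ := by
    intro w k h1 h2
    have hre := (Complex.abs_re_le_norm (w - ⟨reLo k, imLo k⟩)).trans h1
    have him := (Complex.abs_im_le_norm (w - ⟨reLo k, imLo k⟩)).trans h1
    rw [sub_re, abs_sub_comm] at hre
    rw [sub_im, abs_sub_comm] at him
    refine ⟨hre.trans_lt h2, him.trans_lt h2, ?_⟩
    rwa [sub_zero, abs_of_nonneg ((norm_nonneg _).trans h1)]
  obtain ⟨a1, a2, a3⟩ := near z₀ k₀ c0 d0
  obtain ⟨b1, b2, b3⟩ := near z k₁ c1 d1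
  obtain ⟨r1, -, -⟩ := near R kR cR dR
  rw [ofReal_re] at r1
  obtain ⟨⟨q1, q2, q3, q4⟩, q5⟩ := hball
    (y := (((reLo k₀ : ℝ), (imLo k₀ : ℝ), (halfPerimeter k₀ : ℝ)),
      ((reLo k₁ : ℝ), (imLo k₁ : ℝ), (halfPerimeter k₁ : ℝ)), (reLo kR : ℝ))) (by
    simp only [Prod.dist_eq, Real.dist_eq]
    exact max_lt (max_lt a1 (max_lt a2 a3)) (max_lt (max_lt b1 (max_lt b2 b3)) r1))
  simp only [hornerBall_cast] at q1 q2 q3 q4 q5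
  have hRlo : (reLo kR : ℝ) < R := by
    have := ((coe_mem_basicSet_rect nR _).1 mR).1
    rwa [ofReal_re] at this
  obtain ⟨δ', hδ', b, hcell⟩ := exists_forall_cellCert (p₀ := p₀) (pR := pR)
    (isCompact_closedBall z₀ R) hu hD hPu
  -- The first bound makes the cells small enough for the uniform `δ'`; the second keeps every grid
  -- point that needs a cell inside the closed disk of radius `R` about `z₀`.
  obtain ⟨h, hh, hh'⟩ := exists_rat_btwn (show 0 < min (δ' / 2)
    ((R - (ρ + 2 * halfPerimeter k₀)) / 2) from lt_min (by linarith) (by linarith))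
  have hh1 : 2 * (h : ℝ) < δ' := by linarith [hh'.trans_le (min_le_left _ _)]
  have hh2 : 2 * (h : ℝ) < R - (ρ + 2 * halfPerimeter k₀) := by
    linarith [hh'.trans_le (min_le_right _ _)]
  have hh0 : 0 < h := by exact_mod_cast hh
  obtain ⟨N, hN⟩ := exists_nat_ge ((ρ + halfPerimeter k₀) / h)
  rw [div_le_iff₀ hh0] at hN
  obtain ⟨i₀, hi₀⟩ := (hp₀ k₀).2 m0
  obtain ⟨i₁, hi₁⟩ := (hp k₁).2 m1
  obtain ⟨iR, hiR⟩ := (hpR kR).2 mR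
  obtain ⟨cρ, rfl⟩ := exists_ratOf_eq ρ
  obtain ⟨cσ, rfl⟩ := exists_ratOf_eq σ
  obtain ⟨cε, rfl⟩ := exists_ratOf_eq ε
  obtain ⟨cτ, rfl⟩ := exists_ratOf_eq τ
  obtain ⟨ch, rfl⟩ := exists_ratOf_eq h
  -- `B` bounds the search for cell certificates and, being a component of `s`, also delays stage
  -- `s` until all the replies needed are known.
  set B := b + Nat.pair 0 (Encodable.encode e) + Nat.pair (3 * i₀ + 1) k₀
    + Nat.pair (3 * iR + 2) kR + i₁ with hB
  set cert : CertData := (Encodable.encode e, (i₀, k₀), (iR, kR), (i₁, k₁), P,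
    (cρ, cσ, cε, cτ, ch), N) with hcert
  refine ⟨Nat.pair k (Nat.pair (Encodable.encode cert) B), by simp, fun H hH hs => ?_⟩
  replace hs := hs.mono ((Nat.right_le_pair (Encodable.encode cert) B).trans
    (Nat.right_le_pair k _))
  unfold Certified
  simp only [Nat.unpair_pair, Denumerable.ofNat_encode]
  change ValueCert H B k (Encodable.encode e) i₀ k₀ iR kR i₁ k₁ P (ratOf cρ) (ratOf cσ) (ratOf cε)
    (ratOf cτ) (ratOf ch) N
  refine ⟨⟨hs.oracle _ (by omega) ?_, hs.oracle _ (by omega) ?_, hs.oracle _ (by omega) ?_, ?_⟩,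
    ⟨n0, nR, n1⟩, ⟨?_, ?_, hh0, ?_, ?_, ?_, ?_⟩, ⟨?_, fun i _ j _ => ?_⟩, ?_⟩
  · rw [pair_mem_graphSet]; rfl
  · rw [pair_mem_graphSet, hT, triple_second]; exact hi₀
  · rw [pair_mem_graphSet, hT, triple_third]; exact hiR
  · have := hs.input i₁ (by omega)
    rwa [hi₁] at this
  · exact_mod_cast hε
  · exact_mod_cast hσ0
  · exact_mod_cast q1.le
  · exact_mod_cast q2.le
  · exact_mod_cast q3
  · exact_mod_cast q4.le
  · exact_mod_cast hN
  · rw [or_iff_not_imp_left, not_lt]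
    intro hnear
    have hnear' : ((ratOf ch : ℝ) * ((i : ℝ) - N)) ^ 2 + ((ratOf ch : ℝ) * ((j : ℝ) - N)) ^ 2
        ≤ ((ratOf cρ : ℝ) + halfPerimeter k₀ + 2 * ratOf ch) ^ 2 := by exact_mod_cast hnear
    set c : ℂ := ⟨(ratOf ch : ℝ) * ((i : ℝ) - N), (ratOf ch : ℝ) * ((j : ℝ) - N)⟩ with hc
    have hη : (0 : ℝ) ≤ halfPerimeter k₀ := (norm_nonneg _).trans c0
    have hcn : ‖c‖ ≤ (ratOf cρ : ℝ) + halfPerimeter k₀ + 2 * ratOf ch := by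
      refine le_of_sq_le_sq ?_ (by linarith)
      rw [Complex.sq_norm, Complex.normSq_apply]
      simp only [hc]
      linarith
    obtain ⟨n, hn, hcn'⟩ := hcell (reLo k₀ + ratOf ch * ((i : ℚ) - N))
      (imLo k₀ + ratOf ch * ((j : ℚ) - N)) (2 * ratOf ch) (by
        rw [Metric.mem_closedBall, dist_eq_norm]
        have e1 : (⟨((reLo k₀ + ratOf ch * ((i : ℚ) - N) : ℚ) : ℝ),
            ((imLo k₀ + ratOf ch * ((j : ℚ) - N) : ℚ) : ℝ)⟩ : ℂ) - z₀
            = c - (z₀ - ⟨reLo k₀, imLo k₀⟩) := by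
          apply Complex.ext <;> simp [hc] <;> ring
        rw [e1]
        refine (norm_sub_le _ _).trans ?_
        linarith) (by
        push_cast
        rwa [abs_of_pos (by linarith)]) H p hH (hs.mono (by omega))
    exact ⟨n, by omega, by rwa [Denumerable.ofNat_encode]⟩
  · apply intervalIn_of_cast
    push_cast
    exact q5

end Completeness

/-! ### The conjugation machine and the passage from `u` to a holomorphic function -/

/-- The conjugate of the real part of a holomorphic function, as a function on the extended
plane. -/
noncomputable def conjugateOf (F : ℂ → ℂ) (z₀ : ℂ) (s : Sphere) : ℝ :=
  -- The value at infinity is a dummy; the disk lies in the plane.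
  s.elim 0 fun z => (F z).im - (F z₀).im

/-- A machine that computes the conjugate function from the oracle that codes names of the
function, the center, and the radius. -/
theorem exists_conjugation_machine :
    ∃ e' : Nat.Partrec.Code, ∀ (u : Sphere → ℝ) (D : Set Sphere) (F : ℂ → ℂ) (z₀ : ℂ) (R R' : ℝ)
      (X : Set ℕ) (e : Nat.Partrec.Code) (p₀ pR : ℕ → ℕ), 0 < R → R < R' →
      (∀ w ∈ Metric.closedBall z₀ R, (w : Sphere) ∈ D) →
      DifferentiableOn ℂ F (Metric.ball z₀ R') → (∀ w ∈ Metric.ball z₀ R', u w = (F w).re) →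
      IsFunctionName X e D (realFun u) → IsPointName p₀ z₀ → IsPointName pR (R : ℂ) →
      IsFunctionName (graphSet (triple (functionTape X e) p₀ pR)) e'
        ((fun z : ℂ => (z : Sphere)) '' Metric.ball z₀ R) (realFun (conjugateOf F z₀)) := by
  obtain ⟨e', he'⟩ := exists_search_machine primrecPred_certified
  refine ⟨e', fun u D F z₀ R R' X e p₀ pR hR hRR' hD hF hFu hu hp₀ hpR => ?_⟩
  rintro _ ⟨z, hz, rfl⟩ p hp
  have hsub : Metric.ball z₀ R ⊆ Metric.ball z₀ R' := Metric.ball_subset_ball hRR'.le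
  exact he' _ p {k | realFun (conjugateOf F z₀) z ∈ basicSet k} (infinite_setOf_mem_basicSet _)
    (fun H s hH hs => ValueCert.mem_basicSet hH hu
      (fun w hw => hD w (Metric.ball_subset_closedBall hw)) (hF.mono hsub)
      (fun w hw => hFu w (hsub hw)) hp₀ hpR hp hs)
    (fun k hk => exists_certified hu hR hRR' hD hF hFu hp₀ hpR hp hz hk)

/-- A function that is harmonic on a neighbourhood of a closed disk is the real part of a
holomorphic function on a larger disk. -/
theorem IsHarmonicOn.exists_analyticOnNhd {u : Sphere → ℝ} {D : Set Sphere} (hu : IsHarmonicOn u D)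
    {z₀ : ℂ} {R : ℝ} (hR : 0 < R) (hD : ∀ z ∈ Metric.closedBall z₀ R, (z : Sphere) ∈ D) :
    ∃ R' > R, ∃ F : ℂ → ℂ, AnalyticOnNhd ℂ F (Metric.ball z₀ R') ∧
      ∀ w ∈ Metric.ball z₀ R', u w = (F w).re := by
  -- A compact disk in an open set has a thickening in that set, and the thickening is a concentric
  -- larger ball, on which a holomorphic primitive object `F` exists.
  obtain ⟨δ, hδ, hsub⟩ := (isCompact_closedBall z₀ R).exists_thickening_subset_open
    (hu.isOpen.preimage OnePoint.continuous_coe) hD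
  rw [thickening_closedBall hδ hR.le] at hsub
  obtain ⟨F, hF, hFu⟩ := (hu.finite.mono hsub).exists_analyticOnNhd_ball_re_eq
  exact ⟨δ + R, by linarith, F, hF, fun w hw => (hFu hw).symm⟩

end ComputableConjugation

theorem mainTheorem10 :
    -- one machine `M`, without oracle, for all data
    ∃ M : Nat.Partrec.Code,
      ∀ (u : Sphere → ℝ) (D : Set Sphere),
        IsHarmonicOn u D →
      ∀ (z₀ : ℂ) (R : ℝ), 0 < R →
        (∀ z ∈ Metric.closedBall z₀ R, (z : Sphere) ∈ D) →
      ∃ v : Sphere → ℝ,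
        -- `v` is the harmonic conjugate of `u` on the disk that vanishes at its center
        IsHarmonicConjugateOn
          (fun z : ℂ => u (z : Sphere))
          (fun z : ℂ => v (z : Sphere)) (Metric.ball z₀ R) ∧
        v (z₀ : Sphere) = 0 ∧
        -- it is given by the conjugate Poisson integral
        (∀ z ∈ Metric.ball z₀ R, ∀ r : ℝ, ‖z - z₀‖ < r → r < R →
          ((v (z : Sphere) : ℝ) : ℂ) =
            conjugatePoisson
              (fun w : ℂ => u (w : Sphere)) z₀ r z) ∧
        -- from names of `u`, `z₀`, `R`, the machine `M` writes a name of `v`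
        ∀ (X : Set ℕ) (e : Nat.Partrec.Code) (p₀ pR : ℕ → ℕ),
          IsFunctionName X e D (realFun u) →
          IsPointName p₀ (z₀ : Sphere) →
          IsPointName pR ((R : ℂ) : Sphere) →
          ∃ (Y : Set ℕ) (e' : Nat.Partrec.Code),
            Writes M ∅
              (triple (functionTape X e) p₀ pR)
              (functionTape Y e') ∧
            IsFunctionName Y e'
              ((fun z : ℂ => (z : Sphere)) '' Metric.ball z₀ R)
              (realFun v) := by
  obtain ⟨e', he'⟩ := exists_conjugation_machine
  -- `M` depends only on the fixed code `e'`, hence not on `u`, `z₀` or `R`; all data enter through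
  -- the copied tape.
  obtain ⟨M, hM⟩ := exists_copy_machine e'
  refine ⟨M, fun u D hu z₀ R hR hD => ?_⟩
  obtain ⟨R', hRR', F, hF, hFu⟩ := hu.exists_analyticOnNhd hR hD
  have hsub : Metric.ball z₀ R ⊆ Metric.ball z₀ R' := Metric.ball_subset_ball hRR'.le
  refine ⟨conjugateOf F z₀, ?_, sub_self _, fun z _ r hzr hrR => ?_,
    fun X e p₀ pR hX hp₀ hpR => ⟨_, e', hM _, he' u D F z₀ R R' X e p₀ pR hR hRR' hD
      hF.differentiableOn hFu hX hp₀ hpR⟩⟩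
  · exact isHarmonicConjugateOn_re_im Metric.isOpen_ball (hF.mono hsub)
      (fun w hw => hFu w (hsub hw)) fun w _ => rfl
  · exact im_sub_im_eq_conjugatePoisson hF hFu hzr (hrR.trans hRR')
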